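/- **Setting.** Let $\mathcal M$ be the class of Borel measures $s$ on $\mathbb R$ of constant sign, with finite moments of all orders, whose support has infinitely many points. Put $\widehat s(z)=\int \frac{ds(x)}{z-x}$, and for two such measures $\alpha,\beta$ whose supports have disjoint convex hulls let $d\langle\alpha,\beta\rangle(x)=\widehat\beta(x)\,d\alpha(x)$. Let $m\ge 1$ and let $\sigma_1,\dots,\sigma_m\in\mathcal M$. Let $\Delta_j$ be the convex hull in $\mathbb R$ of $\operatorname{supp}\sigma_j$, assume $\Delta_j\cap\Delta_{j+1}=\emptyset$ for $1\le j<m$, and put $\Delta_{m+1}=\emptyset$. For $1\le j\le k\le m$ let $s_{j,j}=\sigma_j$ and $s_{j,k}=\langle\sigma_j,s_{j+1,k}\rangle$ if $j<k$. For $1\le k\le m$ let $r_k=v_k/t_k$ with coprime real polynomials $v_k,t_k$, $\deg v_k<\deg t_k$. Let $T=\operatorname{lcm}(t_1,\dots,t_m)$ and $D=\deg T$. Let $n\ge 2D$ be an integer and let $a_{n,0},\dots,a_{n,m}$ be real polynomials, not all zero, with $\deg a_{n,j}\le n-1$ for $0\le j\le m-1$ and $\deg a_{n,m}\le n$, such that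 the forms $$\mathcal A_{n,0}=a_{n,0}+\sum_{k=1}^m(-1)^k a_{n,k}(\widehat s_{1,k}+r_k),\qquad \mathcal A_{n,j}=(-1)^j a_{n,j}+\sum_{k=j+1}^m(-1)^k a_{n,k}\widehat s_{j+1,k}\quad(1\le j\le m),$$ satisfy $\mathcal A_{n,0}(z)=\mathcal O(z^{-n-1})$ and $\mathcal A_{n,j}(z)=\mathcal O(z^{-1})$ for $1\le j\le m-1$, as $z\to\infty$ non-tangentially to $\Delta_1$ and to $\Delta_{j+1}$ respectively, that is, in each region $\{z:\operatorname{dist}(z,\Delta)\ge c|z|\}$ with $c>0$ (and $\Delta=\Delta_1$, resp. $\Delta=\Delta_{j+1}$). In particular $\mathcal A_{n,m}=(-1)^m a_{n,m}$. A real function on $E\subseteq\mathbb R$ has at least $N$ sign changes in $E$ if there are $x_0<\dots<x_N$ in $E$ at which it is non-zero with alternating signs. Zeros are counted with multiplicity. The form $\mathcal A_{n,0}$ is regarded as a meromorphic function on $\mathbb C\setminus\Delta_1$ (removable singularities are removed). **Statement.** 1. For $j=1,\dots,m$, $\mathcal A_{n,j}$ has at least $n-2D$ sign changes in the interior of $\Delta_j$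 (in $\mathbb R$) and at most $n$ zeros in $\mathbb C\setminus\Delta_{j+1}$. 2. $\mathcal A_{n,0}$ has at most $2D$ zeros in $\mathbb C\setminus\Delta_1$. 3. If no zero of $T$ lies on $\Delta_1$, then $\mathcal A_{n,j}$ has at least $n-D$ sign changes in the interior of $\Delta_j$ for $j=1,\dots,m$, and $\mathcal A_{n,0}$ has at most $D$ zeros in $\mathbb C\setminus\Delta_1$. 4. If no zero of $T$ lies on $\Delta_1$ and $a_{n,m}$ has exactly $n-D$ sign changes on $\Delta_m$, then $\mathcal A_{n,0}$ has no zeros in $\mathbb C\setminus\Delta_1$, and for $j=1,\dots,m-1$ the form $\mathcal A_{n,j}$ has exactly $n-D$ zeros in $\mathbb C\setminus\Delta_{j+1}$; they are all simple and lie on $\Delta_j$. -/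

import Mathlib

open MeasureTheory Polynomial Asymptotics Filter

noncomputable section

namespace MLHP

/-- The support of a signed measure on the real line (the support of its total variation). -/
def supp (s : SignedMeasure ℝ) : Set ℝ := s.variation.support

/-- The smallest interval containing the support of `s`. -/
def hull (s : SignedMeasure ℝ) : Set ℝ := convexHull ℝ (supp s)

/-- The class of Borel measures on the real line of constant sign, with finite moments of all
orders, whose support consists of infinitely many points. (The moment of order zero is finite, so
such a measure is a finite signed measure.) -/
structure ClassM (s : SignedMeasure ℝ) : Prop where
  constSign : 0 ≤ s ∨ s ≤ 0
  moments : ∀ n : ℕ, s.Integrable (fun x : ℝ => x ^ n)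
  infinite_supp : (supp s).Infinite

/-- The Cauchy transform `∫ ds(x) / (z - x)`. -/
def cauchy (s : SignedMeasure ℝ) (z : ℂ) : ℂ := ∫ᵛ x, (z - (x : ℂ))⁻¹ ∂<•s

/-- The measure `⟨α, β⟩`, given by `d⟨α, β⟩(x) = (cauchy β)(x) dα(x)`. The Cauchy transform of `β`
is real on the real line, off the convex hull of the support of `β`. -/
def prodMeasure (α β : SignedMeasure ℝ) : SignedMeasure ℝ :=
  α.withDensity (fun x : ℝ => (cauchy β (x : ℂ)).re) (ContinuousLinearMap.lsmul ℝ ℝ)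

/-- `chain σ j d = ⟨σ_j, ⟨σ_{j+1}, …, σ_{j+d}⟩⟩`. -/
def chain (σ : ℕ → SignedMeasure ℝ) : ℕ → ℕ → SignedMeasure ℝ
  | j, 0 => σ j
  | j, d + 1 => prodMeasure (σ j) (chain σ (j + 1) d)

/-- `s_{j,k} = ⟨σ_j, σ_{j+1}, …, σ_k⟩` for `j ≤ k`. -/
def nikishin (σ : ℕ → SignedMeasure ℝ) (j k : ℕ) : SignedMeasure ℝ := chain σ j (k - j)

/-- `Δ_j` is the convex hull of the support of `σ_j` for `j ≤ m`, and `Δ_j = ∅` for `j > m`. -/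
def Delta (m : ℕ) (σ : ℕ → SignedMeasure ℝ) (j : ℕ) : Set ℝ :=
  if j ≤ m then hull (σ j) else ∅

/-- `(σ_1, …, σ_m)` generates a Nikishin system; values of `σ` at other indices play no role. -/
structure IsNikishinGenerator (m : ℕ) (σ : ℕ → SignedMeasure ℝ) : Prop where
  classM : ∀ j, 1 ≤ j → j ≤ m → ClassM (σ j)
  disjoint : ∀ j, 1 ≤ j → j < m → Disjoint (Delta m σ j) (Delta m σ (j + 1))

/-- A set of real numbers as a subset of the complex plane. -/
def toPlane (E : Set ℝ) : Set ℂ := (fun x : ℝ => (x : ℂ)) '' E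

/-- `f(z) = O(1 / z ^ N)` as `z → ∞` non-tangentially to `E ⊆ ℝ`, that is, in each region
`dist(z, E) ≥ c |z|` with `c > 0`. -/
def BigONontangential (E : Set ℝ) (N : ℕ) (f : ℂ → ℂ) : Prop :=
  ∀ c : ℝ, 0 < c →
    f =O[Bornology.cobounded ℂ ⊓ 𝓟 {z : ℂ | c * ‖z‖ ≤ Metric.infDist z (toPlane E)}]
      (fun z : ℂ => (z ^ N)⁻¹)

/-- `(-1)^j a_j + ∑_{k=j+1}^m (-1)^k a_k ŝ_{j+1,k}`; for `j = m` this is `(-1)^m a_m`. -/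
def nikForm (m : ℕ) (σ : ℕ → SignedMeasure ℝ) (a : ℕ → ℝ[X]) (j : ℕ) (z : ℂ) : ℂ :=
  (-1) ^ j * aeval z (a j) +
    ∑ k ∈ Finset.Icc (j + 1) m, (-1) ^ k * aeval z (a k) * cauchy (nikishin σ (j + 1) k) z

/-- The forms `A_j`, `j = 0, …, m`, attached to polynomials `a_0, …, a_m`:
`A_0 = a_0 + ∑_{k=1}^m (-1)^k a_k (ŝ_{1,k} + v_k / t_k)`, and
`A_j = (-1)^j a_j + ∑_{k=j+1}^m (-1)^k a_k ŝ_{j+1,k}` for `j = 1, …, m`. -/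
def form (m : ℕ) (σ : ℕ → SignedMeasure ℝ) (v t a : ℕ → ℝ[X]) (j : ℕ) (z : ℂ) : ℂ :=
  if j = 0 then
    aeval z (a 0) + ∑ k ∈ Finset.Icc 1 m,
      (-1) ^ k * aeval z (a k) * (cauchy (nikishin σ 1 k) z + aeval z (v k) / aeval z (t k))
  else nikForm m σ a j z

/-- The rational functions `v_k / t_k`, `k = 1, …, m`, are proper and in lowest terms. -/
def IsProperReduced (m : ℕ) (v t : ℕ → ℝ[X]) : Prop :=
  ∀ k, 1 ≤ k → k ≤ m → (v k).degree < (t k).degree ∧ IsCoprime (v k) (t k)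

/-- `T` is a least common multiple of `t_1, …, t_m`. -/
def IsLcm (m : ℕ) (t : ℕ → ℝ[X]) (T : ℝ[X]) : Prop :=
  (∀ k, 1 ≤ k → k ≤ m → t k ∣ T) ∧
    ∀ S : ℝ[X], (∀ k, 1 ≤ k → k ≤ m → t k ∣ S) → T ∣ S

/-- `a_0, …, a_m` are multi-level Hermite–Padé polynomials of index `n` for the Nikishin system
generated by `(σ_1, …, σ_m)` and the rational functions `v_k / t_k`. -/
structure IsMLHermitePade (m n : ℕ) (σ : ℕ → SignedMeasure ℝ) (v t a : ℕ → ℝ[X]) : Prop where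
  degree_lt : ∀ j, j < m → (a j).degree < n
  degree_le : (a m).degree ≤ n
  nontrivial : ∃ j, j ≤ m ∧ a j ≠ 0
  order_zero : BigONontangential (Delta m σ 1) (n + 1) (form m σ v t a 0)
  order : ∀ j, 1 ≤ j → j < m →
    BigONontangential (Delta m σ (j + 1)) 1 (form m σ v t a j)

/-- `f` has at least `N` sign changes in `E`. -/
def AtLeastSignChanges (N : ℕ) (f : ℝ → ℝ) (E : Set ℝ) : Prop :=
  ∃ x : Fin (N + 1) → ℝ, StrictMono x ∧ (∀ i, x i ∈ E) ∧
    ∀ i : Fin N, f (x i.castSucc) * f (x i.succ) < 0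

/-- `f` has exactly `N` sign changes in `E`. -/
def ExactlySignChanges (N : ℕ) (f : ℝ → ℝ) (E : Set ℝ) : Prop :=
  AtLeastSignChanges N f E ∧ ¬ AtLeastSignChanges (N + 1) f E

/-- The multiplicity of `z` as a zero of the function `f`, meromorphic at `z`: it is `0` if `z` is
not a zero (in particular at a pole), and `⊤` if `f` vanishes identically near `z`. -/
def zeroMult (f : ℂ → ℂ) (z : ℂ) : ℕ∞ := (meromorphicOrderAt f z).map Int.toNat

/-- The number of zeros in `U`, with multiplicities, of a function `f` meromorphic in `U`. -/
def numZeros (f : ℂ → ℂ) (U : Set ℂ) : ℕ∞ :=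
  ⨆ (S : Finset ℂ) (_ : (S : Set ℂ) ⊆ U), ∑ z ∈ S, zeroMult f z

end MLHP

end

/-! Up to a polynomial and a sign, each form is the Cauchy transform of the next one: `A_j = P + ∫
A_{j+1}(x) dσ_{j+1}(x) / (z - x)` for `j ≥ 1` (`nikForm_eq`). If `A_j` decays at infinity, then `P =
0`. If moreover a real polynomial `w` collects zeros of `A_j` off `Δ_{j+1}`, then `A_j / w` is the
Cauchy transform of `A_{j+1} dσ_{j+1} / w`, and its decay is improved by `deg w` orders. Hence
`A_{j+1}` is orthogonal to low powers with respect to `dσ_{j+1} / w`, which has constant sign, and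
must change sign on `Δ_{j+1}` (`atLeastSignChanges_succ`).

For `j ≥ 1` the decay is `O(1/z)`, so `N` zeros of `A_j` give `N` sign changes of `A_{j+1}`. These
are again zeros, located off `Δ_{j+2}`, and the argument repeats up to `a_m`, a non-zero polynomial
of degree at most `n`. This bounds zeros from above and carries sign changes upwards in `j`.

At level zero, `T A_0` has no rational terms, decays like `z^{-(n+1-D)}`, and has `T A_1` as its
next form. Testing against multiples of `T` gives the weight `T²` and `deg w + n - 2D` sign changes
of `A_1`. If `T` has no zero on `Δ_1`, then `T` has constant sign there, no extra factor is needed,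
and the number becomes `deg w + n - D`. With `w = 1` these are the lower bounds; with `w` made of
zeros of `A_0`, comparison with the top level bounds the number of those zeros.

Orthogonality yields sign changes only for a function with finitely many zeros on the interval;
`finite_zeros` supplies this. -/

/-! ### Signed measures of constant sign and their densities. -/

theorem MLHP.ClassM.exists_sign {s : SignedMeasure ℝ} (hs : MLHP.ClassM s) :
    ∃ (ρ : Measure ℝ) (_ : IsFiniteMeasure ρ) (ε : ℝ), ε ^ 2 = 1 ∧
      s = ε • ρ.toSignedMeasure ∧ s.variation = ρ := by
  have key : ∀ u : SignedMeasure ℝ, 0 ≤ u → ∃ (ρ : Measure ℝ) (_ : IsFiniteMeasure ρ),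
      u = ρ.toSignedMeasure := by
    intro u hu
    have hu' : 0 ≤[Set.univ] u := (VectorMeasure.le_restrict_univ_iff_le _ _).2 hu
    exact ⟨u.toMeasureOfZeroLE Set.univ MeasurableSet.univ hu', inferInstance,
      (u.toMeasureOfZeroLE_toSignedMeasure hu').symm⟩
  rcases hs.constSign with h | h
  · obtain ⟨ρ, hρ, hsρ⟩ := key s h
    exact ⟨ρ, hρ, 1, by norm_num, by simpa using hsρ, by simp [hsρ]⟩
  · have h' : 0 ≤ -s := by
      intro i hi
      exact neg_nonneg.2 (h i hi)
    obtain ⟨ρ, hρ, hsρ⟩ := key (-s) h'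
    have hs2 : s = -ρ.toSignedMeasure := by rw [← hsρ, neg_neg]
    refine ⟨ρ, hρ, -1, by norm_num, ?_, ?_⟩
    · exact hs2.trans (neg_one_smul ℝ _).symm
    · rw [hs2, VectorMeasure.variation_neg, Measure.variation_toSignedMeasure]

theorem toSignedMeasure_withDensity {ρ : Measure ℝ} [IsFiniteMeasure ρ] {f : ℝ → ℝ}
    (hf : Integrable f ρ) :
    VectorMeasure.withDensity ρ.toSignedMeasure f (ContinuousLinearMap.lsmul ℝ ℝ)
      = ρ.withDensityᵥ f := by
  have hflip : (ContinuousLinearMap.lsmul ℝ ℝ : ℝ →L[ℝ] ℝ →L[ℝ] ℝ)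
      = (ContinuousLinearMap.lsmul ℝ ℝ : ℝ →L[ℝ] ℝ →L[ℝ] ℝ).flip := by
    ext; simp
  ext i hi
  rw [VectorMeasure.withDensity_apply (by rwa [VectorMeasure.Integrable, Measure.variation_toSignedMeasure]), hflip,
    VectorMeasure.setIntegral_toSignedMeasure hi, withDensityᵥ_apply hf hi]

theorem smul_toSignedMeasure_withDensity {ρ : Measure ℝ} [IsFiniteMeasure ρ] {ε : ℝ} (hε : ε ^ 2 = 1)
    {f : ℝ → ℝ} (hf : Integrable f ρ) :
    VectorMeasure.withDensity (ε • ρ.toSignedMeasure) f (ContinuousLinearMap.lsmul ℝ ℝ)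
      = ρ.withDensityᵥ (fun x => ε * f x) := by
  have hv : (ε • ρ.toSignedMeasure).variation = ρ := by
    rw [VectorMeasure.variation_smul, Measure.variation_toSignedMeasure]
    have : ‖ε‖₊ = 1 := by
      rcases eq_or_eq_neg_of_sq_eq_sq ε 1 (by simpa using hε) with h | h <;> simp [h]
    simp [this]
  ext i hi
  rw [VectorMeasure.withDensity_apply (by rwa [VectorMeasure.Integrable, hv]),
    withDensityᵥ_apply (hf.const_mul ε) hi, VectorMeasure.restrict_smul,
    VectorMeasure.integral_smul_vectorMeasure, integral_const_mul,
    ← VectorMeasure.withDensity_apply (by rwa [VectorMeasure.Integrable, Measure.variation_toSignedMeasure]), toSignedMeasure_withDensity hf,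
    withDensityᵥ_apply hf hi, smul_eq_mul]

/-- The signed measure is the difference of the positive measures with densities `f⁺` and `f⁻`; for
each of them the formula is the classical one, and `f⁺ - f⁻ = f`. -/
theorem integral_withDensityV {ρ : Measure ℝ} [IsFiniteMeasure ρ] {f : ℝ → ℝ}
    (hf : Integrable f ρ) {g : ℝ → ℂ} (hg : AEStronglyMeasurable g ρ)
    (hfg : Integrable (fun x => f x • g x) ρ) :
    VectorMeasure.integral (ρ.withDensityᵥ f) g (ContinuousLinearMap.lsmul ℝ ℝ).flip
      = ∫ x, f x • g x ∂ρ := by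
  have h1 := isFiniteMeasure_withDensity_ofReal hf.2
  have h2 := isFiniteMeasure_withDensity_ofReal hf.neg.2
  have m1 : AEMeasurable (fun x => (f x).toNNReal) ρ := hf.aemeasurable.real_toNNReal
  have m2 : AEMeasurable (fun x => (-f x).toNNReal) ρ := hf.neg.aemeasurable.real_toNNReal
  have i1 : Integrable (fun x => (f x).toNNReal • g x) ρ := by
    refine hfg.mono (by exact m1.aestronglyMeasurable.smul hg) (ae_of_all _ fun x => ?_)
    rw [NNReal.smul_def, norm_smul, norm_smul]
    gcongr
    rw [Real.coe_toNNReal', Real.norm_eq_abs, Real.norm_eq_abs]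
    rcases le_total (f x) 0 with h | h
    · simp [h]
    · simp [h]
  have i2 : Integrable (fun x => (-f x).toNNReal • g x) ρ := by
    refine hfg.mono (by exact m2.aestronglyMeasurable.smul hg) (ae_of_all _ fun x => ?_)
    rw [NNReal.smul_def, norm_smul, norm_smul]
    gcongr
    rw [Real.coe_toNNReal', Real.norm_eq_abs, Real.norm_eq_abs]
    rcases le_total (f x) 0 with h | h
    · simp [h, abs_of_nonpos h]
    · simp [h]
  rw [withDensityᵥ_eq_withDensity_pos_part_sub_withDensity_neg_part hf,
    VectorMeasure.integral_sub_vectorMeasure, VectorMeasure.integral_toSignedMeasure,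
    VectorMeasure.integral_toSignedMeasure]
  · rw [show (fun x => ENNReal.ofReal (f x)) = fun x => (((f x).toNNReal : NNReal) : ENNReal) from rfl,
      show (fun x => ENNReal.ofReal (-f x)) = fun x => (((-f x).toNNReal : NNReal) : ENNReal) from rfl,
      integral_withDensity_eq_integral_smul₀ m1, integral_withDensity_eq_integral_smul₀ m2,
      ← integral_sub i1 i2]
    refine integral_congr_ae (ae_of_all _ fun x => ?_)
    simp only [NNReal.smul_def, ← sub_smul, Real.coe_toNNReal']
    congr 1
    rcases le_total (f x) 0 with h | h <;> simp [h]
  · rw [VectorMeasure.Integrable, Measure.variation_toSignedMeasure]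
    exact (integrable_withDensity_iff_integrable_smul₀ m1).2 i1
  · rw [VectorMeasure.Integrable, Measure.variation_toSignedMeasure]
    exact (integrable_withDensity_iff_integrable_smul₀ m2).2 i2

/-! ### Cauchy transforms: polynomial multiples, division by zeros, decay and moments. -/

/-- The Cauchy transform of the complex measure with density `h` with respect to `ρ`. -/
noncomputable def cauchyTransform (ρ : Measure ℝ) (h : ℝ → ℂ) (z : ℂ) : ℂ :=
  ∫ x, h x * (z - (x : ℂ))⁻¹ ∂ρ

/-- The complex measure with density `h` with respect to `ρ` has finite moments. -/
def HasMoments (ρ : Measure ℝ) (h : ℝ → ℂ) : Prop :=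
  ∀ k : ℕ, Integrable (fun x : ℝ => (x : ℂ) ^ k * h x) ρ

theorem isClosed_toPlane {Δ : Set ℝ} (hΔ : IsClosed Δ) : IsClosed (MLHP.toPlane Δ) :=
  Complex.isometry_ofReal.isClosedEmbedding.isClosedMap _ hΔ

theorem ofReal_mem_toPlane {Δ : Set ℝ} {x : ℝ} : (x : ℂ) ∈ MLHP.toPlane Δ ↔ x ∈ Δ :=
  Complex.ofReal_injective.mem_set_image

theorem exists_forall_le_norm_sub {Δ : Set ℝ} (hΔ : IsClosed Δ) {z : ℂ}
    (hz : z ∉ MLHP.toPlane Δ) :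
    ∃ δ > 0, ∀ w ∈ Metric.ball z δ, ∀ x ∈ Δ, δ ≤ ‖w - (x : ℂ)‖ := by
  obtain ⟨ε, hε, h⟩ := Metric.isOpen_iff.1 (isClosed_toPlane hΔ).isOpen_compl z hz
  refine ⟨ε / 2, by positivity, fun w hw x hx => ?_⟩
  have h1 : ε ≤ ‖z - x‖ := by
    by_contra hlt
    push Not at hlt
    exact h (by rwa [Metric.mem_ball, dist_comm, dist_eq_norm]) (ofReal_mem_toPlane.2 hx)
  rw [Metric.mem_ball, dist_comm, dist_eq_norm] at hw
  have := norm_sub_le_norm_sub_add_norm_sub z w x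
  linarith

theorem I_mul_notMem_toPlane (Δ : Set ℝ) {y : ℝ} (hy : 0 < y) :
    (y : ℂ) * Complex.I ∉ MLHP.toPlane Δ := by
  rintro ⟨x, -, hx⟩
  have := congrArg Complex.im hx
  simp at this
  exact hy.ne this

section

variable {ρ : Measure ℝ} {Δ : Set ℝ} {h : ℝ → ℂ}

theorem ne_of_notMem_toPlane {z : ℂ} (hz : z ∉ MLHP.toPlane Δ) {x : ℝ} (hx : x ∈ Δ) :
    z - (x : ℂ) ≠ 0 := fun h0 =>
  hz (sub_eq_zero.1 h0 ▸ ofReal_mem_toPlane.2 hx)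

theorem integrable_mul_inv (hΔ : IsClosed Δ) (hρ : ∀ᵐ x ∂ρ, x ∈ Δ) (hh : Integrable h ρ) {z : ℂ}
    (hz : z ∉ MLHP.toPlane Δ) : Integrable (fun x => h x * (z - (x : ℂ))⁻¹) ρ := by
  obtain ⟨δ, hδ, hb⟩ := exists_forall_le_norm_sub hΔ hz
  refine hh.mul_bdd (c := δ⁻¹) ?_ ?_
  · exact (by fun_prop : Measurable fun x : ℝ => (z - (x : ℂ))⁻¹).aestronglyMeasurable
  · filter_upwards [hρ] with x hx
    rw [norm_inv]
    gcongr
    exact hb z (Metric.mem_ball_self hδ) x hx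

theorem HasMoments.integrable (hh : HasMoments ρ h) : Integrable h ρ := by
  simpa using hh 0

theorem HasMoments.id_mul (hh : HasMoments ρ h) : HasMoments ρ (fun x => (x : ℂ) * h x) := by
  intro k
  convert hh (k + 1) using 2
  ring

theorem HasMoments.const_mul (hh : HasMoments ρ h) (c : ℂ) : HasMoments ρ (fun x => c * h x) := by
  intro k
  convert (hh k).const_mul c using 2
  ring

theorem HasMoments.add {g : ℝ → ℂ} (hh : HasMoments ρ h) (hg : HasMoments ρ g) :
    HasMoments ρ (fun x => h x + g x) := by
  intro k
  convert! (hh k).add (hg k) using 2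
  simp [mul_add]

theorem HasMoments.polynomial_mul (hh : HasMoments ρ h) (p : ℂ[X]) :
    HasMoments ρ (fun x => p.eval (x : ℂ) * h x) := by
  induction p using Polynomial.induction_on with
  | C a => simpa using hh.const_mul a
  | add p q hp hq => simpa [add_mul] using hp.add hq
  | monomial n a ih =>
    convert ih.id_mul using 2
    simp [pow_succ]
    ring

theorem HasMoments.mul_inv (hΔ : IsClosed Δ) (hρ : ∀ᵐ x ∂ρ, x ∈ Δ) (hh : HasMoments ρ h) {z : ℂ}
    (hz : z ∉ MLHP.toPlane Δ) : HasMoments ρ (fun x => h x * (z - (x : ℂ))⁻¹) := by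
  intro k
  convert integrable_mul_inv hΔ hρ (hh k) hz using 2
  ring

theorem differentiableOn_cauchyTransform (hΔ : IsClosed Δ) (hρ : ∀ᵐ x ∂ρ, x ∈ Δ)
    (hh : Integrable h ρ) :
    DifferentiableOn ℂ (cauchyTransform ρ h) (MLHP.toPlane Δ)ᶜ := by
  intro z hz
  obtain ⟨δ, hδ, hb⟩ := exists_forall_le_norm_sub hΔ hz
  refine (hasDerivAt_integral_of_dominated_loc_of_deriv_le (μ := ρ) (𝕜 := ℂ)
    (F := fun z x => h x * (z - (x : ℂ))⁻¹)
    (F' := fun z x => h x * (-1 / (z - (x : ℂ)) ^ 2))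
    (bound := fun x => ‖h x‖ * (δ⁻¹ ^ 2)) (Metric.ball_mem_nhds z hδ) ?_
    (integrable_mul_inv hΔ hρ hh hz) ?_ ?_ ?_ ?_).2.differentiableAt.differentiableWithinAt
  · refine Eventually.of_forall fun w => hh.aestronglyMeasurable.mul ?_
    exact (by fun_prop : Measurable fun x : ℝ => (w - (x : ℂ))⁻¹).aestronglyMeasurable
  · refine hh.aestronglyMeasurable.mul ?_
    exact (by fun_prop : Measurable fun x : ℝ => -1 / (z - (x : ℂ)) ^ 2).aestronglyMeasurable
  · filter_upwards [hρ] with x hx w hw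
    have := hb w hw x hx
    rw [norm_mul, norm_div, norm_neg, norm_one, norm_pow, one_div, inv_pow]
    gcongr
  · exact hh.norm.mul_const _
  · filter_upwards [hρ] with x hx w hw
    have h0 : w - (x : ℂ) ≠ 0 := fun h0 => by
      have := hb w hw x hx
      rw [h0, norm_zero] at this
      linarith
    exact (((hasDerivAt_id w).sub_const (x : ℂ)).inv h0).const_mul (h x)

theorem norm_cauchyTransform_le (hh : Integrable h ρ) {z : ℂ} {δ : ℝ} (hδ : 0 < δ)
    (hb : ∀ᵐ x : ℝ ∂ρ, δ ≤ ‖z - (x : ℂ)‖) :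
    ‖cauchyTransform ρ h z‖ ≤ (∫ x, ‖h x‖ ∂ρ) * δ⁻¹ := by
  rw [cauchyTransform, ← integral_mul_const]
  refine norm_integral_le_of_norm_le (hh.norm.mul_const _) ?_
  filter_upwards [hb] with x hx
  rw [norm_mul, norm_inv]
  gcongr

theorem le_norm_I_mul_sub (y x : ℝ) (hy : 0 < y) : y ≤ ‖(y : ℂ) * Complex.I - (x : ℂ)‖ := by
  have := Complex.abs_im_le_norm ((y : ℂ) * Complex.I - (x : ℂ))
  simpa [abs_of_pos hy] using this

theorem tendsto_cauchyTransform_I (hh : Integrable h ρ) :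
    Tendsto (fun y : ℝ => cauchyTransform ρ h ((y : ℂ) * Complex.I)) atTop (nhds 0) := by
  have h0 : Tendsto (fun y : ℝ => (∫ x, ‖h x‖ ∂ρ) * y⁻¹) atTop (nhds 0) := by
    simpa using tendsto_inv_atTop_zero.const_mul (∫ x, ‖h x‖ ∂ρ)
  refine squeeze_zero_norm' ?_ h0
  filter_upwards [eventually_gt_atTop 0] with y hy
  exact norm_cauchyTransform_le hh hy (ae_of_all _ fun x => le_norm_I_mul_sub y x hy)

/-- This is `z / (z - x) = 1 + x / (z - x)` under the integral; iterated, it moves any polynomial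
factor into the density at the cost of a polynomial. -/
theorem mul_cauchyTransform (hΔ : IsClosed Δ) (hρ : ∀ᵐ x ∂ρ, x ∈ Δ) (hh : HasMoments ρ h) {z : ℂ}
    (hz : z ∉ MLHP.toPlane Δ) :
    z * cauchyTransform ρ h z = (∫ x, h x ∂ρ) + cauchyTransform ρ (fun x => (x : ℂ) * h x) z := by
  rw [cauchyTransform, cauchyTransform, ← integral_const_mul,
    ← integral_add hh.integrable (integrable_mul_inv hΔ hρ hh.id_mul.integrable hz)]
  refine integral_congr_ae ?_
  filter_upwards [hρ] with x hx
  have := ne_of_notMem_toPlane hz hx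
  field_simp
  ring

theorem cauchyTransform_add (hΔ : IsClosed Δ) (hρ : ∀ᵐ x ∂ρ, x ∈ Δ) {g : ℝ → ℂ}
    (hh : Integrable h ρ) (hg : Integrable g ρ) {z : ℂ} (hz : z ∉ MLHP.toPlane Δ) :
    cauchyTransform ρ (fun x => h x + g x) z = cauchyTransform ρ h z + cauchyTransform ρ g z := by
  rw [cauchyTransform, cauchyTransform, cauchyTransform,
    ← integral_add (integrable_mul_inv hΔ hρ hh hz) (integrable_mul_inv hΔ hρ hg hz)]
  simp only [add_mul]

theorem cauchyTransform_const_mul (c z : ℂ) :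
    cauchyTransform ρ (fun x => c * h x) z = c * cauchyTransform ρ h z := by
  rw [cauchyTransform, cauchyTransform, ← integral_const_mul]
  simp only [mul_assoc]

theorem exists_polynomial_mul_cauchyTransform (hΔ : IsClosed Δ) (hρ : ∀ᵐ x ∂ρ, x ∈ Δ)
    (hh : HasMoments ρ h) (p : ℂ[X]) :
    ∃ Q : ℂ[X], ∀ z ∉ MLHP.toPlane Δ, p.eval z * cauchyTransform ρ h z =
      Q.eval z + cauchyTransform ρ (fun x => p.eval (x : ℂ) * h x) z := by
  induction p using Polynomial.induction_on with
  | C a => exact ⟨0, fun z hz => by simp [cauchyTransform_const_mul]⟩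
  | add p q hp hq =>
    obtain ⟨P, hP⟩ := hp
    obtain ⟨Q, hQ⟩ := hq
    refine ⟨P + Q, fun z hz => ?_⟩
    simp only [eval_add, add_mul]
    rw [cauchyTransform_add hΔ hρ (hh.polynomial_mul p).integrable
      (hh.polynomial_mul q).integrable hz, hP z hz, hQ z hz]
    ring
  | monomial n a ih =>
    obtain ⟨Q, hQ⟩ := ih
    have hm := hh.polynomial_mul (C a * X ^ n)
    refine ⟨X * Q + C (∫ x : ℝ, (C a * X ^ n).eval (x : ℂ) * h x ∂ρ), fun z hz => ?_⟩
    have e1 : (C a * X ^ (n + 1)).eval z * cauchyTransform ρ h z =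
        z * ((C a * X ^ n).eval z * cauchyTransform ρ h z) := by
      simp only [eval_mul, eval_C, eval_pow, eval_X]
      ring
    rw [e1, hQ z hz, mul_add, mul_cauchyTransform hΔ hρ hm hz, eval_add, eval_mul, eval_X, eval_C,
      add_assoc]
    congr 3
    funext x
    simp only [eval_mul, eval_C, eval_pow, eval_X]
    ring

/-- Subtract the vanishing value at `z₀` and use `1/(z - x) - 1/(z₀ - x) = (z - z₀) / ((z - x)(x -
z₀))`. -/
theorem cauchyTransform_eq_sub_mul (hΔ : IsClosed Δ) (hρ : ∀ᵐ x ∂ρ, x ∈ Δ)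
    (hh : Integrable h ρ) {z z₀ : ℂ} (hz : z ∉ MLHP.toPlane Δ) (hz₀ : z₀ ∉ MLHP.toPlane Δ)
    (h0 : cauchyTransform ρ h z₀ = 0) :
    cauchyTransform ρ h z =
      (z - z₀) * cauchyTransform ρ (fun x => h x * ((x : ℂ) - z₀)⁻¹) z := by
  rw [← sub_zero (cauchyTransform ρ h z), ← h0, cauchyTransform, cauchyTransform, cauchyTransform,
    ← integral_sub (integrable_mul_inv hΔ hρ hh hz) (integrable_mul_inv hΔ hρ hh hz₀),
    ← integral_const_mul]
  refine integral_congr_ae ?_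
  filter_upwards [hρ] with x hx
  have h1 := ne_of_notMem_toPlane hz hx
  have h2 := ne_of_notMem_toPlane hz₀ hx
  have h3 : (x : ℂ) - z₀ ≠ 0 := by rwa [← neg_sub, neg_ne_zero]
  have h4 : z₀ - (x : ℂ) = -((x : ℂ) - z₀) := by ring
  simp only [h4, inv_neg]
  field_simp
  ring

theorem HasMoments.mul_sub_inv (hΔ : IsClosed Δ) (hρ : ∀ᵐ x ∂ρ, x ∈ Δ) (hh : HasMoments ρ h)
    {z : ℂ} (hz : z ∉ MLHP.toPlane Δ) : HasMoments ρ (fun x => h x * ((x : ℂ) - z)⁻¹) := by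
  convert (hh.mul_inv hΔ hρ hz).const_mul (-1) using 2 with x
  rw [← neg_sub, inv_neg]
  ring

/-- Dividing a Cauchy transform by linear factors at its zeros amounts to dividing its density. -/
theorem cauchyTransform_div_prod (hΔ : IsClosed Δ) (hρ : ∀ᵐ x ∂ρ, x ∈ Δ) (s : Multiset ℂ)
    (hs : ∀ z ∈ s, z ∉ MLHP.toPlane Δ) {g : ℂ → ℂ} (hg : ContinuousOn g (MLHP.toPlane Δ)ᶜ)
    (hh : HasMoments ρ h)
    (hF : ∀ z ∉ MLHP.toPlane Δ, cauchyTransform ρ h z = (s.map (fun a => z - a)).prod * g z) :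
    HasMoments ρ (fun x => h x * (s.map (fun a => (x : ℂ) - a)).prod⁻¹) ∧
    ∀ z ∉ MLHP.toPlane Δ,
      g z = cauchyTransform ρ (fun x => h x * (s.map (fun a => (x : ℂ) - a)).prod⁻¹) z := by
  induction s using Multiset.induction_on generalizing h with
  | empty => exact ⟨by simpa using hh, fun z hz => by simpa using (hF z hz).symm⟩
  | cons a s ih =>
    have ha : a ∉ MLHP.toPlane Δ := hs a (Multiset.mem_cons_self a s)
    have h0 : cauchyTransform ρ h a = 0 := by rw [hF a ha]; simp
    have hm := hh.mul_sub_inv hΔ hρ ha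
    have hopen : IsOpen (MLHP.toPlane Δ)ᶜ := (isClosed_toPlane hΔ).isOpen_compl
    have hc1 : ContinuousOn (cauchyTransform ρ fun x => h x * ((x : ℂ) - a)⁻¹)
        (MLHP.toPlane Δ)ᶜ := (differentiableOn_cauchyTransform hΔ hρ hm.integrable).continuousOn
    have hc2 : ContinuousOn (fun z => (s.map (fun a => z - a)).prod * g z)
        (MLHP.toPlane Δ)ᶜ := by
      refine ContinuousOn.mul (Continuous.continuousOn ?_) hg
      exact continuous_multiset_prod _ fun b _ => by fun_prop
    have hne : ∀ z ∉ MLHP.toPlane Δ, z ≠ a →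
        cauchyTransform ρ (fun x => h x * ((x : ℂ) - a)⁻¹) z
          = (s.map (fun a => z - a)).prod * g z := by
      intro z hz hza
      have := cauchyTransform_eq_sub_mul hΔ hρ hh.integrable hz ha h0
      rw [hF z hz, Multiset.map_cons, Multiset.prod_cons, mul_assoc] at this
      exact (mul_left_cancel₀ (sub_ne_zero.2 hza) this).symm
    have hall : ∀ z ∉ MLHP.toPlane Δ, cauchyTransform ρ (fun x => h x * ((x : ℂ) - a)⁻¹) z
          = (s.map (fun a => z - a)).prod * g z := by
      intro z hz
      -- At `a` the linear factor cannot be cancelled; there both sides are continuous and agree on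
      -- a punctured neighbourhood.
      by_cases hza : z = a
      · subst hza
        have t1 := (hc1.continuousAt (hopen.mem_nhds hz)).tendsto.mono_left
          (nhdsWithin_le_nhds (s := {z}ᶜ))
        have t2 := (hc2.continuousAt (hopen.mem_nhds hz)).tendsto.mono_left
          (nhdsWithin_le_nhds (s := {z}ᶜ))
        refine tendsto_nhds_unique t1 (t2.congr' ?_)
        filter_upwards [self_mem_nhdsWithin, nhdsWithin_le_nhds (hopen.mem_nhds hz)] with y hy hy'
        exact (hne y hy' hy).symm
      · exact hne z hz hza
    obtain ⟨i1, i2⟩ := ih (fun z hz => hs z (Multiset.mem_cons_of_mem hz)) hm hall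
    have e : (fun x : ℝ => h x * ((a ::ₘ s).map (fun a => (x : ℂ) - a)).prod⁻¹) =
        fun x : ℝ => h x * ((x : ℂ) - a)⁻¹ * (s.map (fun a => (x : ℂ) - a)).prod⁻¹ := by
      funext x
      rw [Multiset.map_cons, Multiset.prod_cons, mul_inv, mul_assoc]
    rw [e]
    exact ⟨i1, i2⟩

/-- Decay of a Cauchy transform along the imaginary axis forces moments to vanish. -/
theorem integral_pow_mul_eq_zero (hh : HasMoments ρ h) {K ν : ℕ} (hν : ν + 2 ≤ K)
    (hO : (fun y : ℝ => cauchyTransform ρ h ((y : ℂ) * Complex.I)) =O[atTop]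
      fun y : ℝ => (y ^ K)⁻¹) :
    ∫ x, (x : ℂ) ^ ν * h x ∂ρ = 0 := by
  -- The imaginary half-axis avoids the whole real line, so `Δ = univ` serves and nothing about the
  -- support of `ρ` is required.
  have hmul : ∀ {g : ℝ → ℂ}, HasMoments ρ g → ∀ y : ℝ, 0 < y → (y : ℂ) * Complex.I *
      cauchyTransform ρ g ((y : ℂ) * Complex.I) = (∫ x, g x ∂ρ) +
        cauchyTransform ρ (fun x => (x : ℂ) * g x) ((y : ℂ) * Complex.I) := fun hg y hy =>
    mul_cauchyTransform isClosed_univ (by simp) hg (I_mul_notMem_toPlane _ hy)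
  have hO' : ∀ {g : ℝ → ℂ} {L : ℕ}, HasMoments ρ g →
      ((fun y : ℝ => cauchyTransform ρ g ((y : ℂ) * Complex.I)) =O[atTop]
        fun y : ℝ => (y ^ (L + 1))⁻¹) →
      (fun y : ℝ => (∫ x, g x ∂ρ) +
        cauchyTransform ρ (fun x => (x : ℂ) * g x) ((y : ℂ) * Complex.I)) =O[atTop]
          fun y : ℝ => (y ^ L)⁻¹ := by
    intro g L hg hgO
    have h1 : (fun y : ℝ => (y : ℂ) * Complex.I) =O[atTop] fun y : ℝ => y :=
      IsBigO.of_bound 1 (Eventually.of_forall fun y => by simp)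
    refine (h1.mul hgO).congr' ?_ ?_
    · filter_upwards [eventually_gt_atTop 0] with y hy using hmul hg y hy
    · filter_upwards [eventually_gt_atTop 0] with y hy
      field_simp
      ring
  have hzero : ∀ {g : ℝ → ℂ} {L : ℕ}, HasMoments ρ g →
      ((fun y : ℝ => cauchyTransform ρ g ((y : ℂ) * Complex.I)) =O[atTop]
        fun y : ℝ => (y ^ (L + 2))⁻¹) → ∫ x, g x ∂ρ = 0 := by
    intro g L hg hgO
    have t1 : Tendsto (fun y : ℝ => (∫ x, g x ∂ρ) +
        cauchyTransform ρ (fun x => (x : ℂ) * g x) ((y : ℂ) * Complex.I)) atTop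
          (nhds ((∫ x, g x ∂ρ) + 0)) :=
      (tendsto_cauchyTransform_I hg.id_mul.integrable).const_add _
    have t2 : Tendsto (fun y : ℝ => (y ^ (L + 1))⁻¹) atTop (nhds 0) :=
      (tendsto_pow_atTop (by omega)).inv_tendsto_atTop
    simpa using tendsto_nhds_unique t1 ((hO' hg hgO).trans_tendsto t2)
  -- Once the zeroth moment vanishes, multiplication by `iy` replaces `h` by `x h` and costs one
  -- order of decay.
  induction ν generalizing h K with
  | zero =>
    obtain ⟨L, rfl⟩ : ∃ L, K = L + 2 := ⟨K - 2, by omega⟩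
    simpa using hzero hh hO
  | succ ν ih =>
    obtain ⟨L, rfl⟩ : ∃ L, K = L + 2 := ⟨K - 2, by omega⟩
    have h1 := hO' (L := L + 1) hh hO
    simp only [hzero hh hO, zero_add] at h1
    have := ih hh.id_mul (K := L + 1) (by omega) h1
    rw [← this]
    congr 1
    funext x
    ring

end

/-! ### Sign changes and orthogonality. -/

theorem MLHP.AtLeastSignChanges.cons {N : ℕ} {G : ℝ → ℝ} {E E' : Set ℝ} (hE : E' ⊆ E)
    {z : Fin (N + 1) → ℝ} (hz : StrictMono z) (hzE : ∀ i, z i ∈ E')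
    (hG : ∀ i : Fin N, G (z i.castSucc) * G (z i.succ) < 0) {b : ℝ} (hb : b ∈ E)
    (hbz : b < z 0) (hGb : G b * G (z 0) < 0) : MLHP.AtLeastSignChanges (N + 1) G E := by
  refine ⟨Fin.cons b z, ?_, ?_, ?_⟩
  · refine Fin.strictMono_iff_lt_succ.2 fun i => ?_
    refine Fin.cases ?_ (fun i => ?_) i
    · simpa using hbz
    · simpa [Fin.castSucc_succ] using hz (Fin.castSucc_lt_succ (i := i))
  · intro i
    refine Fin.cases ?_ (fun i => ?_) i
    · simpa using hb
    · simpa using hE (hzE i)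
  · intro i
    refine Fin.cases ?_ (fun i => ?_) i
    · simpa using hGb
    · simpa [Fin.castSucc_succ] using hG i

theorem MLHP.AtLeastSignChanges.mono {N : ℕ} {G : ℝ → ℝ} {E E' : Set ℝ} (hE : E' ⊆ E)
    (h : MLHP.AtLeastSignChanges N G E') : MLHP.AtLeastSignChanges N G E := by
  obtain ⟨x, h1, h2, h3⟩ := h
  exact ⟨x, h1, fun i => hE (h2 i), h3⟩

theorem multiset_prod_sub_sign {x : ℝ} (s : Multiset ℝ) (hs : ∀ y ∈ s, x ≤ y) :
    0 ≤ (-1) ^ s.card * (s.map (fun a => x - a)).prod := by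
  induction s using Multiset.induction_on with
  | empty => simp
  | cons a s ih =>
    rw [Multiset.card_cons, Multiset.map_cons, Multiset.prod_cons, pow_succ]
    have h1 := ih fun y hy => hs y (Multiset.mem_cons_of_mem hy)
    have h2 := hs a (Multiset.mem_cons_self a s)
    have := mul_nonneg (sub_nonneg.2 h2) h1
    linarith

/-- A function with at most `M` sign changes becomes of constant sign after multiplication by a
suitable product of at most `M` linear factors. -/
theorem exists_prod_mul_nonneg (M : ℕ) (G : ℝ → ℝ) (E : Set ℝ)
    (h : ¬ MLHP.AtLeastSignChanges (M + 1) G E) :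
    ∃ (s : Multiset ℝ) (e : ℝ), s.card ≤ M ∧ (∀ c, (∀ x ∈ E, c ≤ x) → ∀ y ∈ s, c ≤ y) ∧
      e ^ 2 = 1 ∧ ∀ x ∈ E, 0 ≤ e * (s.map (fun a => x - a)).prod * G x := by
  induction M generalizing E with
  | zero =>
    have hno : ∀ a ∈ E, ∀ b ∈ E, 0 ≤ G a * G b := by
      have hlt : ∀ a ∈ E, ∀ b ∈ E, a < b → 0 ≤ G a * G b := by
        intro a ha b hb hab
        by_contra! hneg
        refine h (MLHP.AtLeastSignChanges.cons (E' := E) subset_rfl (z := fun _ => b)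
          ?_ (fun _ => hb) (fun i => i.elim0) ha hab hneg)
        intro i j hij
        omega
      intro a ha b hb
      rcases lt_trichotomy a b with hab | hab | hab
      · exact hlt a ha b hb hab
      · rw [hab]
        exact mul_self_nonneg _
      · rw [mul_comm]
        exact hlt b hb a ha hab
    by_cases hpos : ∃ x ∈ E, 0 < G x
    · obtain ⟨x, hx, hGx⟩ := hpos
      refine ⟨0, 1, by simp, by simp, by simp, fun y hy => ?_⟩
      simpa using (mul_nonneg_iff_of_pos_left hGx).1 (hno x hx y hy)
    · push Not at hpos
      refine ⟨0, -1, by simp, by simp, by simp, fun y hy => ?_⟩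
      simpa using hpos y hy
  | succ M ih =>
    by_cases hM : MLHP.AtLeastSignChanges (M + 1) G E
    swap
    · obtain ⟨s, e, h1, h2⟩ := ih E hM
      exact ⟨s, e, by omega, h2⟩
    obtain ⟨x, hx, hxE, hxG⟩ := hM
    have hx01 : G (x 0) * G (x 1) < 0 := hxG 0
    -- `S` holds the points where `G` has the sign opposite to its first one, and `R` is the part of
    -- `E` from `S` onwards. One sign change is used up before `R`, and `sInf S` is the candidate
    -- for the additional root. The lower bound on the roots in the induction hypothesis keeps the
    -- roots for `R` to the right of `E \ R`.
    set S : Set ℝ := {b | b ∈ E ∧ G b * G (x 0) < 0} with hS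
    have hSlb : ∀ b ∈ S, x 0 ≤ b := by
      intro b hb
      by_contra! hlt
      exact h (MLHP.AtLeastSignChanges.cons subset_rfl hx hxE hxG hb.1 hlt hb.2)
    have hSne : S.Nonempty := ⟨x 1, hxE 1, by rwa [mul_comm]⟩
    have hbdd : BddBelow S := ⟨x 0, hSlb⟩
    set R : Set ℝ := {y | y ∈ E ∧ ∃ b ∈ S, b ≤ y} with hR
    have hRlb : ∀ y ∈ R, sInf S ≤ y := by
      rintro y ⟨-, b, hb, hby⟩
      exact (csInf_le hbdd hb).trans hby
    -- A chain of `M + 1` sign changes in `R` extends to the left within `E`: by `x 0` if it starts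
    -- with the opposite sign, otherwise by a point of `S` below its start.
    have hRno : ¬ MLHP.AtLeastSignChanges (M + 1) G R := by
      rintro ⟨z, hz, hzR, hzG⟩
      have hRE : R ⊆ E := fun y hy => hy.1
      have hz0 : G (z 0) ≠ 0 := left_ne_zero_of_mul (hzG 0).ne
      obtain ⟨hz0E, b, hb, hbz⟩ := hzR 0
      have hx0 : G (x 0) ≠ 0 := left_ne_zero_of_mul hx01.ne
      by_cases hzS : G (z 0) * G (x 0) < 0
      · refine h (MLHP.AtLeastSignChanges.cons hRE hz hzR hzG (hxE 0) ?_ (by rwa [mul_comm]))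
        refine lt_of_le_of_ne ((hSlb b hb).trans hbz) fun heq => ?_
        rw [heq] at hzS
        exact absurd hzS (not_lt.2 (mul_self_nonneg _))
      · have hpos : 0 < G (z 0) * G (x 0) :=
          lt_of_le_of_ne (not_lt.1 hzS) (mul_ne_zero hz0 hx0).symm
        have hneg : G b * G (z 0) < 0 := by
          by_contra! hge
          have h1 := mul_neg_of_pos_of_neg hpos hb.2
          have h2 := mul_nonneg hge (mul_self_nonneg (G (x 0)))
          linarith
        refine h (MLHP.AtLeastSignChanges.cons hRE hz hzR hzG hb.1 ?_ hneg)
        refine lt_of_le_of_ne hbz fun heq => ?_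
        rw [heq] at hneg
        exact absurd hneg (not_lt.2 (mul_self_nonneg _))
    obtain ⟨s, e, hcard, hlb, he, hsign⟩ := ih R hRno
    have hlbs : ∀ y ∈ s, sInf S ≤ y := hlb _ hRlb
    have hclb : ∀ c, (∀ x ∈ E, c ≤ x) → c ≤ sInf S := fun c hc =>
      le_csInf hSne fun b hb => hc b hb.1
    have hx0 : G (x 0) ≠ 0 := left_ne_zero_of_mul hx01.ne
    obtain ⟨η, hη, hηG⟩ : ∃ η : ℝ, η ^ 2 = 1 ∧ 0 < η * G (x 0) := by
      rcases lt_or_gt_of_ne hx0 with h0 | h0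
      · exact ⟨-1, by norm_num, by linarith⟩
      · exact ⟨1, by norm_num, by linarith⟩
    have hL : ∀ y ∈ E, y ∉ R → y ≤ sInf S ∧ 0 ≤ η * G y := by
      intro y hy hyR
      have hyb : ∀ b ∈ S, y < b := fun b hb => by
        by_contra! hle
        exact hyR ⟨hy, b, hb, hle⟩
      refine ⟨le_csInf hSne fun b hb => (hyb b hb).le, ?_⟩
      have hyS : ¬ G y * G (x 0) < 0 := fun hlt => lt_irrefl y (hyb y ⟨hy, hlt⟩)
      by_contra! hneg
      refine hyS ?_
      have := mul_neg_of_neg_of_pos hneg hηG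
      have e1 : η * G y * (η * G (x 0)) = η ^ 2 * (G y * G (x 0)) := by ring
      rwa [e1, hη, one_mul] at this
    -- This number is the sign of `e · ∏ · G` on `E \ R`, left of all roots. If it is `1`, no root
    -- is added; if it is `-1`, the root `sInf S` corrects the sign there without disturbing `R`.
    have hτ : (e * (-1) ^ s.card * η) ^ 2 = 1 := by
      rw [mul_pow, mul_pow, he, hη, ← pow_mul, mul_comm s.card, pow_mul]
      norm_num
    rcases sq_eq_one_iff.1 hτ with hτ1 | hτ1
    · refine ⟨s, e, by omega, fun c hc y hy => (hclb c hc).trans (hlbs y hy), he, fun y hy => ?_⟩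
      by_cases hyR : y ∈ R
      · exact hsign y hyR
      · obtain ⟨h1, h2⟩ := hL y hy hyR
        have h3 := multiset_prod_sub_sign (x := y) s fun w hw => h1.trans (hlbs w hw)
        have h4 := mul_nonneg h3 h2
        have hκ : ((-1 : ℝ) ^ s.card) ^ 2 = 1 := by
          rw [← pow_mul, mul_comm, pow_mul]; norm_num
        calc (0 : ℝ) ≤ (e * (-1) ^ s.card * η) *
              ((-1) ^ s.card * (s.map (fun a => y - a)).prod * (η * G y)) := by
                rw [hτ1, one_mul]; exact h4
          _ = ((-1) ^ s.card) ^ 2 * η ^ 2 * (e * (s.map (fun a => y - a)).prod * G y) := by ring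
          _ = e * (s.map (fun a => y - a)).prod * G y := by rw [hκ, hη]; ring
    · refine ⟨sInf S ::ₘ s, e, by simpa using hcard, ?_, he, fun y hy => ?_⟩
      · intro c hc y hy
        rcases Multiset.mem_cons.1 hy with rfl | hy
        · exact hclb c hc
        · exact (hclb c hc).trans (hlbs y hy)
      rw [Multiset.map_cons, Multiset.prod_cons]
      by_cases hyR : y ∈ R
      · have := mul_nonneg (sub_nonneg.2 (hRlb y hyR)) (hsign y hyR)
        linarith
      · obtain ⟨h1, h2⟩ := hL y hy hyR
        have h3 := multiset_prod_sub_sign (x := y) s fun w hw => h1.trans (hlbs w hw)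
        have h4 := mul_nonneg (mul_nonneg h3 h2) (sub_nonneg.2 h1)
        have hκ : ((-1 : ℝ) ^ s.card) ^ 2 = 1 := by
          rw [← pow_mul, mul_comm, pow_mul]; norm_num
        calc (0 : ℝ) ≤ (-(e * (-1) ^ s.card * η)) *
              ((-1) ^ s.card * (s.map (fun a => y - a)).prod * (η * G y) * (sInf S - y)) := by
                rw [hτ1, neg_neg, one_mul]; exact h4
          _ = ((-1) ^ s.card) ^ 2 * η ^ 2 *
              (e * ((y - sInf S) * (s.map (fun a => y - a)).prod) * G y) := by ring
          _ = e * ((y - sInf S) * (s.map (fun a => y - a)).prod) * G y := by rw [hκ, hη]; ring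

/-- If `f x ≠ 0`, then `f` is non-zero on a neighbourhood of `x` in `Δ`; but every neighbourhood of
a support point has positive mass. -/
theorem eq_zero_of_mem_support_of_ae {ρ : Measure ℝ} {Δ : Set ℝ} (hρ : ∀ᵐ x ∂ρ, x ∈ Δ)
    {f : ℝ → ℝ} (hf : ContinuousOn f Δ) (h0 : ∀ᵐ x ∂ρ, f x = 0) {x : ℝ} (hx : x ∈ ρ.support)
    (hxΔ : x ∈ Δ) : f x = 0 := by
  by_contra hne
  have hU := hf x hxΔ (isOpen_ne.mem_nhds hne)
  rw [mem_map, mem_nhdsWithin] at hU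
  obtain ⟨U, hU, hxU, hsub⟩ := hU
  have hpos := (Measure.mem_support_iff_forall x).1 hx U (hU.mem_nhds hxU)
  refine hpos.ne' ?_
  have : ∀ᵐ y ∂ρ, y ∉ U := by
    filter_upwards [hρ, h0] with y h1 h2 hy
    exact hsub ⟨hy, h1⟩ h2
  simpa [ae_iff] using this

/-- A function orthogonal to all polynomials of degree less than `K` has at least `K` sign changes,
unless it has infinitely many zeros. -/
theorem atLeastSignChanges_of_orthogonal {ρ : Measure ℝ} {Δ : Set ℝ} (hΔ : IsClosed Δ)
    (hconv : Convex ℝ Δ) (hint : (interior Δ).Nonempty) (hρ : ∀ᵐ x ∂ρ, x ∈ Δ)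
    (hsupp : ρ.support.Infinite) (hsub : ρ.support ⊆ Δ) {G u : ℝ → ℝ} (hG : ContinuousOn G Δ)
    (hu : ContinuousOn u Δ) (hu0 : ∀ x ∈ Δ, 0 ≤ u x) (hufin : {x ∈ Δ | u x = 0}.Finite)
    {K : ℕ} (horth : ∀ q : ℝ[X], q.natDegree < K →
      Integrable (fun x => q.eval x * G x * u x) ρ ∧ ∫ x, q.eval x * G x * u x ∂ρ = 0)
    (hGfin : {x ∈ Δ | G x = 0}.Finite) :
    MLHP.AtLeastSignChanges K G (interior Δ) := by
  by_contra hK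
  cases K with
  | zero =>
    obtain ⟨x, hx⟩ := hint
    exact hK ⟨fun _ => x, fun i j hij => by omega, fun _ => hx, fun i => i.elim0⟩
  | succ M =>
    obtain ⟨s, e, hcard, -, he, hsign⟩ := exists_prod_mul_nonneg M G _ hK
    set q : ℝ[X] := C e * (s.map (fun a => X - C a)).prod with hq
    have he0 : e ≠ 0 := by
      rintro rfl
      norm_num at he
    have hq0 : q ≠ 0 := by
      refine mul_ne_zero (by simpa using he0) (Multiset.prod_ne_zero ?_)
      simp [X_sub_C_ne_zero]
    have hqdeg : q.natDegree < M + 1 := by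
      rw [hq, natDegree_C_mul he0, natDegree_multiset_prod_X_sub_C_eq_card]
      omega
    have hqe : ∀ x, q.eval x = e * (s.map (fun a => x - a)).prod := by
      intro x
      rw [hq, eval_mul, eval_C, eval_multiset_prod, Multiset.map_map]
      simp
    have hqG : ContinuousOn (fun x => q.eval x * G x) Δ := q.continuous.continuousOn.mul hG
    have hnonneg : ∀ x ∈ Δ, 0 ≤ q.eval x * G x := by
      -- The sign is controlled only on the interior; a convex set with non-empty interior lies in
      -- the closure of that interior, so the inequality passes to the endpoints.
      have hcl : closure (interior Δ) = Δ := by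
        rw [hconv.closure_interior_eq_closure_of_nonempty_interior hint, hΔ.closure_eq]
      intro x hx
      have hx' : x ∈ closure (interior Δ) := by rwa [hcl]
      have := mem_closure_iff_nhdsWithin_neBot.1 hx'
      refine ge_of_tendsto ((hqG x hx).mono interior_subset) ?_
      filter_upwards [self_mem_nhdsWithin] with y hy
      rw [hqe]
      exact hsign y hy
    obtain ⟨hi, hz⟩ := horth q hqdeg
    -- A non-negative integrand with integral zero vanishes at every support point, which puts the
    -- infinite support inside finitely many zeros of `q`, `G` and `u`.
    have hae : ∀ᵐ x ∂ρ, q.eval x * G x * u x = 0 := by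
      have := (integral_eq_zero_iff_of_nonneg_ae ?_ hi).1 hz
      · exact this
      · filter_upwards [hρ] with x hx
        exact mul_nonneg (hnonneg x hx) (hu0 x hx)
    refine hsupp ((((q.roots.toFinset.finite_toSet).union hGfin).union hufin).subset ?_)
    intro x hx
    have hxΔ := hsub hx
    have := eq_zero_of_mem_support_of_ae hρ (hqG.mul hu) hae hx hxΔ
    rcases mul_eq_zero.1 this with h1 | h1
    · rcases mul_eq_zero.1 h1 with h2 | h2
      · left; left
        simpa [hq0] using h2
      · left; right
        exact ⟨hxΔ, h2⟩
    · right
      exact ⟨hxΔ, h1⟩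

/-! ### Zeros recorded by a polynomial, and the resulting orthogonality. -/

/-- The zeros of the real polynomial `w` lie in `U` and are zeros of `f`, with multiplicities. -/
def HasZeros (f : ℂ → ℂ) (U : Set ℂ) (w : ℝ[X]) : Prop :=
  w ≠ 0 ∧ (∀ z : ℂ, aeval z w = 0 → z ∈ U) ∧
    ∃ g : ℂ → ℂ, ContinuousOn g U ∧ ∀ z ∈ U, f z = aeval z w * g z

theorem aeval_eq_leadingCoeff_mul_prod (w : ℝ[X]) (z : ℂ) :
    aeval z w = (w.map (algebraMap ℝ ℂ)).leadingCoeff *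
      ((w.map (algebraMap ℝ ℂ)).roots.map (fun a => z - a)).prod := by
  have h := congrArg (eval z) (IsAlgClosed.splits (w.map (algebraMap ℝ ℂ))).eq_prod_roots
  rw [aeval_def, ← eval_map, h, eval_mul, eval_C, eval_multiset_prod, Multiset.map_map]
  simp

theorem isBigO_eval_I (p : ℂ[X]) {d : ℕ} (hd : p.natDegree ≤ d) :
    (fun y : ℝ => p.eval ((y : ℂ) * Complex.I)) =O[atTop] fun y : ℝ => y ^ d := by
  simp only [eval_eq_sum_range]
  refine IsBigO.fun_sum fun i hi => IsBigO.const_mul_left ?_ _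
  rw [Finset.mem_range] at hi
  refine IsBigO.of_bound 1 ?_
  filter_upwards [eventually_ge_atTop 1] with y hy
  have h0 : (0 : ℝ) ≤ y := by linarith
  simp only [norm_pow, norm_mul, Complex.norm_I, mul_one, one_mul, Complex.norm_real,
    Real.norm_eq_abs, abs_of_nonneg h0]
  exact pow_le_pow_right₀ hy (by omega)

theorem tendsto_norm_I_atTop :
    Tendsto (fun y : ℝ => ‖(y : ℂ) * Complex.I‖) atTop atTop := by
  simpa using tendsto_abs_atTop_atTop

theorem eq_zero_of_tendsto_eval_I {p : ℂ[X]}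
    (h : Tendsto (fun y : ℝ => p.eval ((y : ℂ) * Complex.I)) atTop (nhds 0)) : p = 0 := by
  by_cases hd : 0 < p.degree
  · have h1 := p.tendsto_norm_atTop hd tendsto_norm_I_atTop
    have h2 := h.norm
    exact absurd h1 (not_tendsto_atTop_of_tendsto_nhds h2)
  · rw [eq_C_of_degree_le_zero (not_lt.1 hd)] at h ⊢
    simp only [eval_C] at h
    rw [tendsto_nhds_unique tendsto_const_nhds h, C_0]

theorem isBigO_inv_prod_I (s : Multiset ℂ) :
    (fun y : ℝ => (s.map (fun a => (y : ℂ) * Complex.I - a)).prod⁻¹) =O[atTop]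
      fun y : ℝ => (y ^ s.card)⁻¹ := by
  induction s using Multiset.induction_on with
  | empty => simpa using isBigO_refl (fun _ : ℝ => (1 : ℂ)) atTop |>.norm_right
  | cons a s ih =>
    have h1 : (fun y : ℝ => ((y : ℂ) * Complex.I - a)⁻¹) =O[atTop] fun y : ℝ => y⁻¹ := by
      refine IsBigO.of_bound 2 ?_
      filter_upwards [eventually_gt_atTop 0, eventually_ge_atTop (2 * ‖a‖)] with y hy hya
      have h2 : y / 2 ≤ ‖(y : ℂ) * Complex.I - a‖ := by
        have := norm_sub_norm_le ((y : ℂ) * Complex.I) a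
        simp only [norm_mul, Complex.norm_I, mul_one, Complex.norm_real, Real.norm_eq_abs,
          abs_of_pos hy] at this
        linarith
      rw [norm_inv, norm_inv, Real.norm_eq_abs, abs_of_pos hy]
      calc ‖(y : ℂ) * Complex.I - a‖⁻¹ ≤ (y / 2)⁻¹ := by gcongr
        _ = 2 * y⁻¹ := by rw [inv_div]; ring
    refine (h1.mul ih).congr_left (fun y => ?_) |>.congr_right fun y => ?_
    · rw [Multiset.map_cons, Multiset.prod_cons, mul_inv]
    · rw [Multiset.card_cons, pow_succ', mul_inv]

section

variable {ρ : Measure ℝ} {Δ : Set ℝ} {h : ℝ → ℂ}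

/-- Decay forces `P = 0`. Dividing by the factors at the zeros then gives the Cauchy transform of
the divided density, of order `y^{-(s.card + N)}`, so its moments up to `s.card + N - 2` vanish. -/
theorem integral_mul_div_prod_eq_zero (hΔ : IsClosed Δ) (hρ : ∀ᵐ x ∂ρ, x ∈ Δ)
    (hh : HasMoments ρ h) {P : ℂ[X]} {F : ℂ → ℂ}
    (hF : ∀ z ∉ MLHP.toPlane Δ, F z = P.eval z + cauchyTransform ρ h z) {N : ℕ} (hN : 1 ≤ N)
    (hO : (fun y : ℝ => F ((y : ℂ) * Complex.I)) =O[atTop] fun y : ℝ => (y ^ N)⁻¹)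
    {s : Multiset ℂ} (hs : ∀ z ∈ s, z ∉ MLHP.toPlane Δ) {g : ℂ → ℂ}
    (hg : ContinuousOn g (MLHP.toPlane Δ)ᶜ)
    (hFg : ∀ z ∉ MLHP.toPlane Δ, F z = (s.map (fun a => z - a)).prod * g z)
    {q : ℂ[X]} (hq : q.natDegree + 2 ≤ s.card + N) :
    HasMoments ρ (fun x => h x * (s.map (fun a => (x : ℂ) - a)).prod⁻¹) ∧
    ∫ x, q.eval (x : ℂ) * (h x * (s.map (fun a => (x : ℂ) - a)).prod⁻¹) ∂ρ = 0 := by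
  have hP : P = 0 := by
    refine eq_zero_of_tendsto_eval_I ?_
    have t1 : Tendsto (fun y : ℝ => F ((y : ℂ) * Complex.I)) atTop (nhds 0) :=
      hO.trans_tendsto (tendsto_pow_atTop (by omega)).inv_tendsto_atTop
    have t2 := t1.sub (tendsto_cauchyTransform_I hh.integrable)
    rw [sub_zero] at t2
    refine t2.congr' ?_
    filter_upwards [eventually_gt_atTop 0] with y hy
    rw [hF _ (I_mul_notMem_toPlane Δ hy)]
    ring
  have hF' : ∀ z ∉ MLHP.toPlane Δ,
      cauchyTransform ρ h z = (s.map (fun a => z - a)).prod * g z := by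
    intro z hz
    rw [← hFg z hz, hF z hz, hP]
    simp
  obtain ⟨hm, hgC⟩ := cauchyTransform_div_prod hΔ hρ s hs hg hh hF'
  refine ⟨hm, ?_⟩
  have hdecay : (fun y : ℝ => cauchyTransform ρ
      (fun x => h x * (s.map (fun a => (x : ℂ) - a)).prod⁻¹) ((y : ℂ) * Complex.I)) =O[atTop]
      fun y : ℝ => (y ^ (s.card + N))⁻¹ := by
    refine ((isBigO_inv_prod_I s).mul hO).congr' ?_ ?_
    · have hlarge : ∀ᶠ y : ℝ in atTop, ∀ a ∈ s.toFinset, ‖a‖ < y :=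
        (Filter.eventually_all_finset s.toFinset).2 fun a _ => eventually_gt_atTop ‖a‖
      filter_upwards [eventually_gt_atTop 0, hlarge] with y hy hya
      have hy' := I_mul_notMem_toPlane Δ hy
      have hne : (s.map (fun a => (y : ℂ) * Complex.I - a)).prod ≠ 0 := by
        refine Multiset.prod_ne_zero fun h0 => ?_
        obtain ⟨a, ha, ha0⟩ := Multiset.mem_map.1 h0
        have h1 := hya a (Multiset.mem_toFinset.2 ha)
        rw [← sub_eq_zero.1 ha0, norm_mul, Complex.norm_I, mul_one, Complex.norm_real,
          Real.norm_eq_abs, abs_of_pos hy] at h1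
        exact lt_irrefl _ h1
      rw [← hgC _ hy', hFg _ hy']
      field_simp
    · refine Eventually.of_forall fun y => ?_
      simp only [pow_add, mul_inv]
  simp only [eval_eq_sum_range, Finset.sum_mul]
  rw [integral_finsetSum]
  · refine Finset.sum_eq_zero fun i hi => ?_
    rw [Finset.mem_range] at hi
    simp only [mul_assoc]
    rw [integral_const_mul, integral_pow_mul_eq_zero hm (ν := i) (by omega) hdecay, mul_zero]
  · intro i _
    convert (hm i).const_mul (q.coeff i) using 2
    ring

/-- Zeros of a decaying Cauchy transform give orthogonality relations with varying weight. -/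
theorem integral_mul_div_eq_zero (hΔ : IsClosed Δ) (hρ : ∀ᵐ x ∂ρ, x ∈ Δ) {G : ℝ → ℝ}
    (hG : HasMoments ρ (fun x => (G x : ℂ))) {P : ℂ[X]} {F : ℂ → ℂ}
    (hF : ∀ z ∉ MLHP.toPlane Δ, F z = P.eval z + cauchyTransform ρ (fun x => (G x : ℂ)) z)
    {N : ℕ} (hN : 1 ≤ N)
    (hO : (fun y : ℝ => F ((y : ℂ) * Complex.I)) =O[atTop] fun y : ℝ => (y ^ N)⁻¹)
    {w : ℝ[X]} (hw : HasZeros F (MLHP.toPlane Δ)ᶜ w)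
    {q : ℝ[X]} (hq : q.natDegree + 2 ≤ w.natDegree + N) :
    Integrable (fun x => q.eval x * G x * (w.eval x)⁻¹) ρ ∧
      ∫ x, q.eval x * G x * (w.eval x)⁻¹ ∂ρ = 0 := by
  obtain ⟨-, hroots, g, hg, hFg⟩ := hw
  set W : ℂ[X] := w.map (algebraMap ℝ ℂ) with hW
  have hprod : ∀ z, aeval z w = W.leadingCoeff * (W.roots.map (fun a => z - a)).prod :=
    aeval_eq_leadingCoeff_mul_prod w
  have hcard : W.roots.card = w.natDegree := by
    rw [← (IsAlgClosed.splits W).natDegree_eq_card_roots, hW, natDegree_map]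
  obtain ⟨hm, hz⟩ := integral_mul_div_prod_eq_zero hΔ hρ hG hF hN hO (s := W.roots)
    (fun z hz => hroots z (by rw [hprod, Multiset.prod_eq_zero, mul_zero]
                              exact Multiset.mem_map.2 ⟨z, hz, sub_self z⟩))
    (g := fun z => W.leadingCoeff * g z) (hg.const_mul _)
    (fun z hz => by rw [hFg z hz, hprod]; ring)
    (q := q.map (algebraMap ℝ ℂ)) (by rw [natDegree_map, hcard]; exact hq)
  have heq : ∀ x : ℝ, ((q.eval x * G x * (w.eval x)⁻¹ : ℝ) : ℂ) =
      W.leadingCoeff⁻¹ * ((q.map (algebraMap ℝ ℂ)).eval (x : ℂ) *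
        ((G x : ℂ) * (W.roots.map (fun a => (x : ℂ) - a)).prod⁻¹)) := by
    intro x
    have h1 : ((w.eval x : ℝ) : ℂ) = aeval (x : ℂ) w := (aeval_algebraMap_apply_eq_algebraMap_eval x w).symm
    have h2 : ((q.eval x : ℝ) : ℂ) = (q.map (algebraMap ℝ ℂ)).eval (x : ℂ) := by
      rw [eval_map, ← aeval_def]
      exact (aeval_algebraMap_apply_eq_algebraMap_eval x q).symm
    push_cast
    rw [h1, h2, hprod, mul_inv]
    ring
  have hint := (hm.polynomial_mul (q.map (algebraMap ℝ ℂ))).integrable.const_mul W.leadingCoeff⁻¹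
  simp only [← heq] at hint
  refine ⟨?_, ?_⟩
  · simpa using hint.re
  · rw [← Complex.ofReal_inj, ← integral_complex_ofReal]
    simp only [heq]
    rw [integral_const_mul, hz, mul_zero, Complex.ofReal_zero]

end

/-! ### Counting zeros with multiplicity by real polynomials. -/

/-- Factors are removed one at a time with `dslope`, which stays holomorphic on `U` and lowers the
order by one at `a` and nowhere else. -/
theorem exists_eq_multiset_prod_mul {U : Set ℂ} (hU : IsOpen U) (s : Multiset ℂ) {f : ℂ → ℂ}
    (hf : DifferentiableOn ℂ f U) (hs : ∀ z ∈ s, z ∈ U)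
    (hord : ∀ z ∈ U, (s.count z : ℕ∞) ≤ analyticOrderAt f z) :
    ∃ g : ℂ → ℂ, DifferentiableOn ℂ g U ∧
      ∀ z ∈ U, f z = (s.map (fun a => z - a)).prod * g z := by
  classical
  induction s using Multiset.induction_on generalizing f with
  | empty => exact ⟨f, hf, by simp⟩
  | cons a s ih =>
    have haU : a ∈ U := hs a (Multiset.mem_cons_self a s)
    have hfa : f a = 0 := by
      refine apply_eq_zero_of_analyticOrderAt_ne_zero fun h0 => ?_
      have := hord a haU
      rw [h0, Multiset.count_cons_self] at this
      simp at this
    have hd : DifferentiableOn ℂ (dslope f a) U :=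
      (Complex.differentiableOn_dslope (hU.mem_nhds haU)).2 hf
    have hfac : f = (fun z => z - a) * dslope f a := by
      funext z
      have := sub_smul_dslope f a z
      rw [hfa, sub_zero, smul_eq_mul] at this
      exact this.symm
    obtain ⟨g, hg, hfg⟩ := ih hd (fun z hz => hs z (Multiset.mem_cons_of_mem hz)) (by
      intro z hz
      have h1 := hord z hz
      have hlin : AnalyticAt ℂ (fun z : ℂ => z - a) z := by fun_prop
      rw [hfac, analyticOrderAt_mul hlin (hd.analyticAt (hU.mem_nhds hz))] at h1
      by_cases hza : z = a
      · subst hza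
        have h2 : analyticOrderAt (fun w : ℂ => w - z) z = 1 := analyticOrderAt_id_sub_const_self
        rw [h2, Multiset.count_cons_self, Nat.cast_add, Nat.cast_one, add_comm] at h1
        exact (ENat.add_le_add_iff_left (by simp)).1 h1
      · have h2 : analyticOrderAt (fun w : ℂ => w - a) z = 0 :=
          hlin.analyticOrderAt_eq_zero.2 (sub_ne_zero.2 hza)
        rwa [h2, zero_add, Multiset.count_cons_of_ne hza] at h1)
    refine ⟨g, hg, fun z hz => ?_⟩
    rw [Multiset.map_cons, Multiset.prod_cons, mul_assoc, ← hfg z hz]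
    exact congrFun hfac z

/-- Conjugating a local factorisation `f = (w - z)^k g` gives one at the conjugate point. -/
theorem analyticOrderAt_le_conj {f : ℂ → ℂ} {z : ℂ}
    (hconj : ∀ᶠ w in nhds z, f (starRingEnd ℂ w) = starRingEnd ℂ (f w)) (hf : AnalyticAt ℂ f z)
    (hf' : AnalyticAt ℂ f (starRingEnd ℂ z)) {k : ℕ} (hk : (k : ℕ∞) ≤ analyticOrderAt f z) :
    (k : ℕ∞) ≤ analyticOrderAt f (starRingEnd ℂ z) := by
  obtain ⟨g, hg, hfg⟩ := (natCast_le_analyticOrderAt hf).1 hk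
  have hcont : Tendsto (starRingEnd ℂ) (nhds (starRingEnd ℂ z)) (nhds z) := by
    simpa using (Complex.continuous_conj.tendsto (starRingEnd ℂ z))
  refine (natCast_le_analyticOrderAt hf').2 ⟨fun w => starRingEnd ℂ (g (starRingEnd ℂ w)), ?_, ?_⟩
  · rw [Complex.analyticAt_iff_eventually_differentiableAt] at hg ⊢
    filter_upwards [hcont.eventually hg] with w hw
    have := hw.conj_conj
    rwa [Complex.conj_conj] at this
  · filter_upwards [hcont.eventually hfg, hcont.eventually hconj] with w hw h1
    rw [Complex.conj_conj, hw] at h1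
    rw [h1]
    simp

/-- Zeros of a real function in a domain are the zeros of a real polynomial. -/
theorem exists_hasZeros {U : Set ℂ} (hU : IsOpen U) (hUc : ∀ z ∈ U, starRingEnd ℂ z ∈ U)
    {f : ℂ → ℂ} (hf : DifferentiableOn ℂ f U)
    (hconj : ∀ z ∈ U, f (starRingEnd ℂ z) = starRingEnd ℂ (f z)) {S : Finset ℂ} (hS : (S : Set ℂ) ⊆ U)
    {k : ℂ → ℕ} (hk : ∀ z ∈ S, (k z : ℕ∞) ≤ analyticOrderAt f z) :
    ∃ w : ℝ[X], HasZeros f U w ∧ ∑ z ∈ S, k z ≤ w.natDegree := by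
  classical
  -- Outside `S` the values of `k` are arbitrary and are replaced by `0`. Taking the larger
  -- multiplicity of `z` and its conjugate makes the multiset invariant under conjugation, so the
  -- product of its linear factors has real coefficients.
  set k' : ℂ → ℕ := fun z => if z ∈ S then k z else 0 with hk'
  set κ : ℂ → ℕ := fun z => max (k' z) (k' (starRingEnd ℂ z)) with hκ
  set S' : Finset ℂ := S ∪ S.image (starRingEnd ℂ) with hS'
  set s : Multiset ℂ := ∑ a ∈ S', Multiset.replicate (κ a) a with hs
  have hκconj : ∀ z, κ (starRingEnd ℂ z) = κ z := fun z => by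
    simp only [hκ, Complex.conj_conj, max_comm]
  have hκ0 : ∀ z, z ∉ S' → κ z = 0 := by
    intro z hz
    simp only [hS', Finset.mem_union, Finset.mem_image, not_or, not_exists, not_and] at hz
    have h2 : starRingEnd ℂ z ∉ S := fun h => hz.2 _ h (Complex.conj_conj z)
    simp [hκ, hk', hz.1, h2]
  have hcount : ∀ z, s.count z = κ z := by
    intro z
    rw [hs, Multiset.count_sum']
    simp only [Multiset.count_replicate]
    rw [Finset.sum_ite_eq']
    split_ifs with h
    · rfl
    · exact (hκ0 z h).symm
  have hS'U : ∀ z ∈ S', z ∈ U := by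
    intro z hz
    rcases Finset.mem_union.1 hz with h | h
    · exact hS h
    · obtain ⟨a, ha, rfl⟩ := Finset.mem_image.1 h
      exact hUc a (hS ha)
  have hsU : ∀ z ∈ s, z ∈ U := by
    intro z hz
    refine hS'U z ?_
    by_contra h
    have := Multiset.count_pos.2 hz
    rw [hcount, hκ0 z h] at this
    exact lt_irrefl _ this
  have han : ∀ z ∈ U, AnalyticAt ℂ f z := fun z hz => hf.analyticAt (hU.mem_nhds hz)
  have hk'ord : ∀ z ∈ U, (k' z : ℕ∞) ≤ analyticOrderAt f z := by
    intro z hz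
    by_cases h : z ∈ S
    · simpa [hk', h] using hk z h
    · simp [hk', h]
  obtain ⟨g, hg, hfg⟩ := exists_eq_multiset_prod_mul hU s hf hsU (by
    intro z hz
    have h1 := analyticOrderAt_le_conj
      (mem_of_superset (hU.mem_nhds (hUc z hz)) hconj) (han _ (hUc z hz)) (by simpa using han z hz)
      (hk'ord _ (hUc z hz))
    rw [Complex.conj_conj] at h1
    rw [hcount]
    rcases max_choice (k' z) (k' (starRingEnd ℂ z)) with h | h
    · simpa only [hκ, h] using hk'ord z hz
    · simpa only [hκ, h] using h1)
  have hsconj : s.map (starRingEnd ℂ) = s := by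
    refine Multiset.ext.2 fun z => ?_
    have := Multiset.count_map_eq_count' (starRingEnd ℂ) s (star_injective) (starRingEnd ℂ z)
    rw [Complex.conj_conj, hcount, hκconj] at this
    rw [this, hcount]
  set W : ℂ[X] := (s.map (fun a => X - C a)).prod with hW
  have hWconj : W.map (starRingEnd ℂ) = W := by
    rw [hW, Polynomial.map_multiset_prod, Multiset.map_map]
    conv_rhs => rw [← hsconj, Multiset.map_map]
    simp
  obtain ⟨w, hw⟩ : ∃ w : ℝ[X], w.map (algebraMap ℝ ℂ) = W := by
    rw [← mem_lifts, lifts_iff_coeff_lifts]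
    intro n
    have := congrArg (fun p => p.coeff n) hWconj
    simp only [coeff_map] at this
    exact ⟨(W.coeff n).re, (Complex.conj_eq_iff_re.1 this)⟩
  have haeval : ∀ z, aeval z w = (s.map (fun a => z - a)).prod := by
    intro z
    rw [aeval_def, ← eval_map, hw, hW, eval_multiset_prod, Multiset.map_map]
    simp
  have hdeg : w.natDegree = s.card := by
    rw [← natDegree_map (algebraMap ℝ ℂ), hw, hW, natDegree_multiset_prod_X_sub_C_eq_card]
  have hW0 : W ≠ 0 := (monic_multiset_prod_of_monic _ _ fun a _ => monic_X_sub_C a).ne_zero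
  refine ⟨w, ⟨?_, ?_, g, hg.continuousOn, fun z hz => ?_⟩, ?_⟩
  · rintro rfl
    simp at hw
    exact hW0 hw.symm
  · intro z hz
    rw [haeval, Multiset.prod_eq_zero_iff] at hz
    obtain ⟨a, ha, ha0⟩ := Multiset.mem_map.1 hz
    rw [sub_eq_zero.1 ha0]
    exact hsU a ha
  · rw [haeval, hfg z hz]
  · rw [hdeg, hs, Multiset.card_sum]
    simp only [Multiset.card_replicate]
    calc ∑ z ∈ S, k z ≤ ∑ z ∈ S, κ z := by
          refine Finset.sum_le_sum fun z hz => ?_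
          simp [hκ, hk', hz]
      _ ≤ ∑ z ∈ S', κ z := Finset.sum_le_sum_of_subset Finset.subset_union_left

theorem exists_of_not_numZeros_le {f : ℂ → ℂ} {U : Set ℂ} {N : ℕ}
    (h : ¬ MLHP.numZeros f U ≤ N) :
    ∃ (S : Finset ℂ) (k : ℂ → ℕ), (S : Set ℂ) ⊆ U ∧
      (∀ z ∈ S, (k z : ℕ∞) ≤ MLHP.zeroMult f z) ∧ N + 1 ≤ ∑ z ∈ S, k z := by
  rw [MLHP.numZeros, iSup₂_le_iff] at h
  push Not at h
  obtain ⟨S, hS, hlt⟩ := h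
  -- Multiplicities may be `⊤`; truncated at `N + 1` they become natural numbers whose sum still
  -- exceeds `N`.
  refine ⟨S, fun z => (min (MLHP.zeroMult f z) ((N + 1 : ℕ) : ℕ∞)).toNat, hS, ?_, ?_⟩
  · intro z _
    rw [ENat.natCast_toNat (by simp)]
    exact min_le_left _ _
  · by_cases hbig : ∃ z ∈ S, ((N + 1 : ℕ) : ℕ∞) ≤ MLHP.zeroMult f z
    · obtain ⟨z, hz, hle⟩ := hbig
      refine le_trans ?_ (Finset.single_le_sum (fun _ _ => Nat.zero_le _) hz)
      rw [min_eq_right hle, ENat.toNat_natCast]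
    · push Not at hbig
      have : ∑ z ∈ S, MLHP.zeroMult f z =
          ((∑ z ∈ S, (min (MLHP.zeroMult f z) ((N + 1 : ℕ) : ℕ∞)).toNat : ℕ) : ℕ∞) := by
        push_cast
        refine Finset.sum_congr rfl fun z hz => ?_
        rw [← Nat.cast_one, ← Nat.cast_add, ENat.natCast_toNat (by simp),
          min_eq_left (hbig z hz).le]
      rw [this] at hlt
      exact_mod_cast hlt

theorem zeroMult_eq_analyticOrderAt {f : ℂ → ℂ} {z : ℂ} (hf : AnalyticAt ℂ f z) :
    MLHP.zeroMult f z = analyticOrderAt f z := by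
  rw [MLHP.zeroMult, hf.meromorphicOrderAt_eq]
  cases h : analyticOrderAt f z with
  | top => rfl
  | coe n => rfl

theorem exists_finset_zeros_of_signChanges {Δ : Set ℝ} (hconv : Convex ℝ Δ) {G : ℝ → ℝ}
    (hG : ContinuousOn G Δ) {N : ℕ} (h : MLHP.AtLeastSignChanges N G Δ) :
    ∃ S : Finset ℝ, S.card = N ∧ ∀ x ∈ S, x ∈ Δ ∧ G x = 0 := by
  classical
  obtain ⟨x, hx, hxΔ, hxG⟩ := h
  have hord := hconv.ordConnected
  have key : ∀ i : Fin N, ∃ y ∈ Set.Ioo (x i.castSucc) (x i.succ), G y = 0 := by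
    intro i
    have hlt : x i.castSucc < x i.succ := hx Fin.castSucc_lt_succ
    have hc : ContinuousOn G (Set.Icc (x i.castSucc) (x i.succ)) :=
      hG.mono (hord.out (hxΔ _) (hxΔ _))
    rcases mul_neg_iff.1 (hxG i) with ⟨h1, h2⟩ | ⟨h1, h2⟩
    · exact intermediate_value_Ioo' hlt.le hc ⟨h2, h1⟩
    · exact intermediate_value_Ioo hlt.le hc ⟨h1, h2⟩
  choose y hy hy0 using key
  have hmono : StrictMono y := by
    intro i j hij
    refine (hy i).2.trans_le (le_trans (hx.monotone ?_) (hy j).1.le)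
    exact Fin.succ_le_castSucc_iff.2 hij
  refine ⟨Finset.univ.image y, ?_, ?_⟩
  · rw [Finset.card_image_of_injective _ hmono.injective, Finset.card_univ, Fintype.card_fin]
  · intro a ha
    obtain ⟨i, -, rfl⟩ := Finset.mem_image.1 ha
    exact ⟨hord.out (hxΔ _) (hxΔ _) (Set.Ioo_subset_Icc_self (hy i)), hy0 i⟩

/-! ### Geometry of the intervals and the densities of the product measures. -/

/-- A point outside both `S` and its hull has positive distance from `S`, and `S` lies on one side
of it, since otherwise it would be in the hull. So the hull lies in a closed half-line away from the
point. -/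
theorem isClosed_convexHull_real {S : Set ℝ} (hS : IsClosed S) : IsClosed (convexHull ℝ S) := by
  have hord := (convex_convexHull ℝ S).ordConnected
  refine isClosed_of_closure_subset fun x hx => ?_
  by_contra hxC
  have hxS : x ∉ S := fun h => hxC (subset_convexHull ℝ S h)
  obtain ⟨δ, hδ, hball⟩ := Metric.isOpen_iff.1 hS.isOpen_compl x hxS
  have hfar : ∀ a ∈ S, δ ≤ |a - x| := fun a ha => by
    by_contra! h
    exact hball (by rwa [Metric.mem_ball, Real.dist_eq]) ha
  have hside : (∀ a ∈ S, x + δ ≤ a) ∨ ∀ a ∈ S, a ≤ x - δ := by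
    by_contra! h
    obtain ⟨⟨a, ha, hax⟩, b, hb, hbx⟩ := h
    have ha' := hfar a ha
    have hb' := hfar b hb
    rcases le_abs.1 ha' with h1 | h1
    · linarith
    rcases le_abs.1 hb' with h2 | h2
    · exact hxC (hord.out (subset_convexHull ℝ S ha) (subset_convexHull ℝ S hb)
        ⟨by linarith, by linarith⟩)
    · linarith
  rcases hside with h | h
  · have h1 : convexHull ℝ S ⊆ Set.Ici (x + δ) := convexHull_min h (convex_Ici _)
    have h2 : x ∈ Set.Ici (x + δ) := closure_minimal h1 isClosed_Ici hx
    rw [Set.mem_Ici] at h2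
    linarith
  · have h1 : convexHull ℝ S ⊆ Set.Iic (x - δ) := convexHull_min h (convex_Iic _)
    have h2 : x ∈ Set.Iic (x - δ) := closure_minimal h1 isClosed_Iic hx
    rw [Set.mem_Iic] at h2
    linarith

/-- On the line one set lies entirely before the other, and the gap between its supremum and the
infimum of the other is positive, even if both are unbounded. This gap is what bounds the densities.
-/
theorem exists_forall_le_abs_sub {A B : Set ℝ} (hA : IsClosed A) (hB : IsClosed B)
    (hAc : Convex ℝ A) (hBc : Convex ℝ B) (hAB : Disjoint A B) :
    ∃ δ > 0, ∀ a ∈ A, ∀ b ∈ B, δ ≤ |a - b| := by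
  have key : ∀ {A B : Set ℝ}, IsClosed A → IsClosed B → Convex ℝ A → Convex ℝ B →
      Disjoint A B → ∀ p ∈ A, ∀ q ∈ B, p < q → ∃ δ > 0, ∀ a ∈ A, ∀ b ∈ B, δ ≤ b - a := by
    intro A B hA hB hAc hBc hAB p hp q hq hpq
    have hlt : ∀ a ∈ A, ∀ b ∈ B, a < b := by
      intro a ha b hb
      by_contra! hba
      rcases le_total b p with h | h
      · exact Set.disjoint_left.1 hAB hp (hBc.ordConnected.out hb hq ⟨h, hpq.le⟩)
      · exact Set.disjoint_left.1 hAB (hAc.ordConnected.out hp ha ⟨h, hba⟩) hb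
    have hAb : BddAbove A := ⟨q, fun a ha => (hlt a ha q hq).le⟩
    have hBb : BddBelow B := ⟨p, fun b hb => (hlt p hp b hb).le⟩
    have h1 := hA.csSup_mem ⟨p, hp⟩ hAb
    have h2 := hB.csInf_mem ⟨q, hq⟩ hBb
    refine ⟨sInf B - sSup A, sub_pos.2 (hlt _ h1 _ h2), fun a ha b hb => ?_⟩
    have := le_csSup hAb ha
    have := csInf_le hBb hb
    linarith
  rcases A.eq_empty_or_nonempty with rfl | ⟨p, hp⟩
  · exact ⟨1, one_pos, by simp⟩
  rcases B.eq_empty_or_nonempty with rfl | ⟨q, hq⟩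
  · exact ⟨1, one_pos, by simp⟩
  rcases lt_trichotomy p q with h | h | h
  · obtain ⟨δ, hδ, hd⟩ := key hA hB hAc hBc hAB p hp q hq h
    exact ⟨δ, hδ, fun a ha b hb => by rw [abs_sub_comm]; exact (hd a ha b hb).trans (le_abs_self _)⟩
  · exact absurd hq (Set.disjoint_left.1 hAB (h ▸ hp))
  · obtain ⟨δ, hδ, hd⟩ := key hB hA hBc hAc hAB.symm q hq p hp h
    exact ⟨δ, hδ, fun a ha b hb => (hd b hb a ha).trans (le_abs_self _)⟩

namespace MLHP

theorem isClosed_Delta (m : ℕ) (σ : ℕ → SignedMeasure ℝ) (j : ℕ) : IsClosed (Delta m σ j) := by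
  unfold Delta
  split_ifs
  · exact isClosed_convexHull_real Measure.isClosed_support
  · exact isClosed_empty

theorem convex_Delta (m : ℕ) (σ : ℕ → SignedMeasure ℝ) (j : ℕ) : Convex ℝ (Delta m σ j) := by
  unfold Delta
  split_ifs
  · exact convex_convexHull ℝ _
  · exact convex_empty

theorem support_subset_Delta {m : ℕ} {σ : ℕ → SignedMeasure ℝ} {j : ℕ} (hj : j ≤ m) :
    (σ j).variation.support ⊆ Delta m σ j := by
  rw [Delta, if_pos hj]
  exact subset_convexHull ℝ _

theorem ae_mem_Delta {m : ℕ} {σ : ℕ → SignedMeasure ℝ} {j : ℕ} (hj : j ≤ m) :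
    ∀ᵐ x ∂(σ j).variation, x ∈ Delta m σ j :=
  mem_of_superset Measure.support_mem_ae (support_subset_Delta hj)

theorem Delta_succ (m : ℕ) (σ : ℕ → SignedMeasure ℝ) : Delta m σ (m + 1) = ∅ := by
  simp [Delta]

theorem ClassM.interior_hull_nonempty {s : SignedMeasure ℝ} (hs : ClassM s) :
    (interior (hull s)).Nonempty := by
  obtain ⟨a, ha, b, hb, hab⟩ := hs.infinite_supp.nontrivial.exists_lt
  have hord := (convex_convexHull ℝ (supp s)).ordConnected
  have h1 : Set.Ioo a b ⊆ interior (hull s) :=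
    interior_maximal (Set.Ioo_subset_Icc_self.trans
      (hord.out (subset_convexHull ℝ _ ha) (subset_convexHull ℝ _ hb))) isOpen_Ioo
  exact (Set.nonempty_Ioo.2 hab).mono h1

/-- The density of `⟨σ_j, …, σ_{j+d}⟩` with respect to `σ_j`. -/
noncomputable def dens (σ : ℕ → SignedMeasure ℝ) (j : ℕ) : ℕ → ℝ → ℝ
  | 0, _ => 1
  | d + 1, x => (cauchy (chain σ (j + 1) d) (x : ℂ)).re

end MLHP

theorem ContinuousOn.aestronglyMeasurable_of_ae_mem {ρ : Measure ℝ} {Δ : Set ℝ} (hΔ : IsClosed Δ)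
    (hρ : ∀ᵐ x ∂ρ, x ∈ Δ) {f : ℝ → ℝ} (hf : ContinuousOn f Δ) : AEStronglyMeasurable f ρ := by
  rw [← Measure.restrict_eq_self_of_ae_mem hρ]
  exact hf.aestronglyMeasurable hΔ.measurableSet

theorem hasMoments_ofReal {ρ : Measure ℝ} {Δ : Set ℝ} (hΔ : IsClosed Δ)
    (hρ : ∀ᵐ x ∂ρ, x ∈ Δ) (hmom : ∀ n : ℕ, Integrable (fun x : ℝ => x ^ n) ρ) {f : ℝ → ℝ}
    (hf : ContinuousOn f Δ) {c : ℝ} (hc : ∀ x ∈ Δ, |f x| ≤ c) :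
    HasMoments ρ (fun x => (f x : ℂ)) := by
  intro k
  have h1 : Integrable (fun x : ℝ => x ^ k * f x) ρ := by
    refine (hmom k).mul_bdd (c := c) (hf.aestronglyMeasurable_of_ae_mem hΔ hρ) ?_
    filter_upwards [hρ] with x hx using hc x hx
  have h2 := h1.ofReal (𝕜 := ℂ)
  simpa using h2

namespace MLHP

theorem cauchy_chain_zero {σ : ℕ → SignedMeasure ℝ} {j : ℕ} {ρ : Measure ℝ} [IsFiniteMeasure ρ]
    {ε : ℝ} (hσ : σ j = ε • ρ.toSignedMeasure) (z : ℂ) :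
    cauchy (chain σ j 0) z = ε * cauchyTransform ρ (fun x => (dens σ j 0 x : ℂ)) z := by
  rw [cauchy, chain, hσ, VectorMeasure.integral_smul_vectorMeasure,
    VectorMeasure.integral_toSignedMeasure, cauchyTransform, Complex.real_smul]
  simp [dens]

theorem cauchy_chain_succ {σ : ℕ → SignedMeasure ℝ} {j d : ℕ} {ρ : Measure ℝ} [IsFiniteMeasure ρ]
    {ε : ℝ} (hε : ε ^ 2 = 1) (hσ : σ j = ε • ρ.toSignedMeasure) {Δ : Set ℝ} (hΔ : IsClosed Δ)
    (hρ : ∀ᵐ x ∂ρ, x ∈ Δ) (hint : Integrable (dens σ j (d + 1)) ρ) {z : ℂ}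
    (hz : z ∉ toPlane Δ) :
    cauchy (chain σ j (d + 1)) z =
      ε * cauchyTransform ρ (fun x => (dens σ j (d + 1) x : ℂ)) z := by
  have h1 := integrable_mul_inv hΔ hρ ((hint.const_mul ε).ofReal (𝕜 := ℂ)) hz
  rw [cauchy, chain, prodMeasure, hσ]
  change VectorMeasure.integral (VectorMeasure.withDensity (ε • ρ.toSignedMeasure)
    (dens σ j (d + 1)) _) _ _ = _
  rw [smul_toSignedMeasure_withDensity hε hint, integral_withDensityV (hint.const_mul ε)
    (by fun_prop : Measurable fun x : ℝ => (z - (x : ℂ))⁻¹).aestronglyMeasurable h1,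
    cauchyTransform, ← integral_const_mul]
  congr 1
  funext x
  simp only [Complex.real_smul]
  push_cast
  ring

/-- The three claims feed each other. The representation at level `j + 1` makes the next density
continuous on `Δ_j`; the gap between the intervals bounds it; boundedness makes it integrable, which
gives the representation at level `j`. -/
theorem IsNikishinGenerator.chain_spec {m : ℕ} {σ : ℕ → SignedMeasure ℝ}
    (hσ : IsNikishinGenerator m σ) (d : ℕ) {j : ℕ} (hj : 1 ≤ j) (hjm : j + d ≤ m) :
    ContinuousOn (dens σ j d) (Delta m σ j) ∧
    (∃ c, ∀ x ∈ Delta m σ j, |dens σ j d x| ≤ c) ∧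
    ∀ (ρ : Measure ℝ) [IsFiniteMeasure ρ] (ε : ℝ), ε ^ 2 = 1 → σ j = ε • ρ.toSignedMeasure →
      (σ j).variation = ρ → ∀ z ∉ toPlane (Delta m σ j), cauchy (chain σ j d) z =
        ε * cauchyTransform ρ (fun x => (dens σ j d x : ℂ)) z := by
  induction d generalizing j with
  | zero =>
    refine ⟨continuousOn_const, ⟨1, fun x _ => by simp [dens]⟩, fun ρ _ ε _ h _ z _ => ?_⟩
    exact cauchy_chain_zero h z
  | succ d ih =>
    obtain ⟨ih1, ⟨c, hc⟩, ih3⟩ := ih (j := j + 1) (by omega) (by omega)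
    obtain ⟨ρ', hρ'fin, ε', hε', hσ', hvar'⟩ := (hσ.classM (j + 1) (by omega) (by omega)).exists_sign
    have hrep := ih3 ρ' ε' hε' hσ' hvar'
    have hdisj := hσ.disjoint j hj (by omega)
    have hae' : ∀ᵐ x ∂ρ', x ∈ Delta m σ (j + 1) := hvar' ▸ ae_mem_Delta (by omega)
    have hmom' : ∀ n : ℕ, Integrable (fun x : ℝ => x ^ n) ρ' := fun n =>
      hvar' ▸ (hσ.classM (j + 1) (by omega) (by omega)).moments n
    have hI' : Integrable (fun x => (dens σ (j + 1) d x : ℂ)) ρ' :=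
      (hasMoments_ofReal (isClosed_Delta _ _ _) hae' hmom' ih1 hc).integrable
    have hnot : ∀ x ∈ Delta m σ j, (x : ℂ) ∉ toPlane (Delta m σ (j + 1)) := fun x hx h =>
      Set.disjoint_left.1 hdisj hx (ofReal_mem_toPlane.1 h)
    have hcont : ContinuousOn (dens σ j (d + 1)) (Delta m σ j) := by
      have h1 : ContinuousOn (fun x : ℝ => (ε' * cauchyTransform ρ'
          (fun x => (dens σ (j + 1) d x : ℂ)) (x : ℂ)).re) (Delta m σ j) := by
        refine Complex.continuous_re.comp_continuousOn (ContinuousOn.const_mul ?_ _)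
        exact (differentiableOn_cauchyTransform (isClosed_Delta _ _ _) hae' hI').continuousOn.comp
          Complex.continuous_ofReal.continuousOn hnot
      refine h1.congr fun x hx => ?_
      rw [dens, hrep _ (hnot x hx)]
    have hbdd : ∃ c, ∀ x ∈ Delta m σ j, |dens σ j (d + 1) x| ≤ c := by
      obtain ⟨δ, hδ, hdist⟩ := exists_forall_le_abs_sub (isClosed_Delta m σ j)
        (isClosed_Delta m σ (j + 1)) (convex_Delta _ _ _) (convex_Delta _ _ _) hdisj
      refine ⟨|ε'| * ((∫ x, ‖(dens σ (j + 1) d x : ℂ)‖ ∂ρ') * δ⁻¹), fun x hx => ?_⟩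
      rw [dens, hrep _ (hnot x hx)]
      refine (Complex.abs_re_le_norm _).trans ?_
      rw [norm_mul, Complex.norm_real, Real.norm_eq_abs]
      gcongr
      refine norm_cauchyTransform_le hI' hδ ?_
      filter_upwards [hae'] with y hy
      rw [← Complex.ofReal_sub, Complex.norm_real]
      exact hdist x hx y hy
    refine ⟨hcont, hbdd, fun ρ _ ε hε h hvar z hz => ?_⟩
    have hae : ∀ᵐ x ∂ρ, x ∈ Delta m σ j := hvar ▸ ae_mem_Delta (by omega)
    have hmom : ∀ n : ℕ, Integrable (fun x : ℝ => x ^ n) ρ := fun n =>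
      hvar ▸ (hσ.classM j (by omega) (by omega)).moments n
    obtain ⟨c', hc'⟩ := hbdd
    have hI := (hasMoments_ofReal (isClosed_Delta m σ j) hae hmom hcont hc').integrable
    have hI2 : Integrable (dens σ j (d + 1)) ρ := by simpa using hI.re
    exact cauchy_chain_succ hε h (isClosed_Delta _ _ _) hae hI2 hz

end MLHP

theorem cauchyTransform_conj {ρ : Measure ℝ} (f : ℝ → ℝ) (z : ℂ) :
    cauchyTransform ρ (fun x => (f x : ℂ)) (starRingEnd ℂ z) =
      starRingEnd ℂ (cauchyTransform ρ (fun x => (f x : ℂ)) z) := by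
  rw [cauchyTransform, cauchyTransform, ← integral_conj]
  simp

theorem exists_sum_mul_cauchyTransform {ρ : Measure ℝ} {Δ : Set ℝ} (hΔ : IsClosed Δ)
    (hρ : ∀ᵐ x ∂ρ, x ∈ Δ) (s : Finset ℕ) (p : ℕ → ℂ[X]) {h : ℕ → ℝ → ℂ}
    (hh : ∀ k ∈ s, HasMoments ρ (h k)) :
    HasMoments ρ (fun x => ∑ k ∈ s, (p k).eval (x : ℂ) * h k x) ∧
    ∃ Q : ℂ[X], ∀ z ∉ MLHP.toPlane Δ, ∑ k ∈ s, (p k).eval z * cauchyTransform ρ (h k) z =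
      Q.eval z + cauchyTransform ρ (fun x => ∑ k ∈ s, (p k).eval (x : ℂ) * h k x) z := by
  classical
  induction s using Finset.induction_on with
  | empty => exact ⟨fun k => by simp, 0, fun z _ => by simp [cauchyTransform]⟩
  | insert a s ha ih =>
    obtain ⟨hm, Q, hQ⟩ := ih fun k hk => hh k (Finset.mem_insert_of_mem hk)
    have hma := (hh a (Finset.mem_insert_self a s)).polynomial_mul (p a)
    obtain ⟨R, hR⟩ := exists_polynomial_mul_cauchyTransform hΔ hρ
      (hh a (Finset.mem_insert_self a s)) (p a)
    simp only [Finset.sum_insert ha]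
    refine ⟨hma.add hm, R + Q, fun z hz => ?_⟩
    rw [hR z hz, hQ z hz, cauchyTransform_add hΔ hρ hma.integrable hm.integrable hz, eval_add]
    ring

/-! ### The forms as iterated Cauchy transforms. -/

namespace MLHP

variable {m : ℕ} {σ : ℕ → SignedMeasure ℝ}

/-- All the measures `s_{j+1,k}` have a density with respect to `σ_{j+1}`, so a single sign `ε`
serves every `k`. -/
theorem IsNikishinGenerator.exists_cauchy_eq (hσ : IsNikishinGenerator m σ) {j : ℕ} (hj : j < m) :
    ∃ ε : ℝ, ε ^ 2 = 1 ∧ ∀ k ∈ Finset.Icc (j + 1) m,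
      HasMoments (σ (j + 1)).variation (fun x => (dens σ (j + 1) (k - (j + 1)) x : ℂ)) ∧
      ContinuousOn (dens σ (j + 1) (k - (j + 1))) (Delta m σ (j + 1)) ∧
      ∀ z ∉ toPlane (Delta m σ (j + 1)), cauchy (nikishin σ (j + 1) k) z =
        ε * cauchyTransform (σ (j + 1)).variation
          (fun x => (dens σ (j + 1) (k - (j + 1)) x : ℂ)) z := by
  have hM := hσ.classM (j + 1) (by omega) (by omega)
  obtain ⟨ρ, hρ, ε, hε, hs, hvar⟩ := hM.exists_sign
  refine ⟨ε, hε, fun k hk => ?_⟩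
  rw [Finset.mem_Icc] at hk
  obtain ⟨h1, ⟨c, hc⟩, h3⟩ := hσ.chain_spec (k - (j + 1)) (j := j + 1) (by omega) (by omega)
  refine ⟨hasMoments_ofReal (isClosed_Delta m σ (j + 1)) (ae_mem_Delta (by omega)) hM.moments h1 hc,
    h1, fun z hz => ?_⟩
  rw [nikishin, h3 ρ ε hε hs hvar z hz, hvar]

/-- The polynomial term becomes the summand `k = j`, with density `1`. In this shape the form of
level `j` is the combined density of the form one level below. -/
theorem nikForm_re (b : ℕ → ℝ[X]) {j : ℕ} (hj : j ≤ m) (x : ℝ) :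
    (nikForm m σ b j (x : ℂ)).re =
      ∑ k ∈ Finset.Icc j m, (-1) ^ k * (b k).eval x * dens σ j (k - j) x := by
  have haeval : ∀ p : ℝ[X], aeval (x : ℂ) p = ((p.eval x : ℝ) : ℂ) := fun p =>
    aeval_algebraMap_apply_eq_algebraMap_eval x p
  have hpow : ∀ k : ℕ, ((-1 : ℂ)) ^ k = (((-1 : ℝ) ^ k : ℝ) : ℂ) := fun k => by push_cast; rfl
  rw [nikForm, ← Finset.insert_Icc_add_one_left_eq_Icc hj, Finset.sum_insert (by simp),
    Complex.add_re, Complex.re_sum]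
  congr 1
  · rw [haeval, hpow, ← Complex.ofReal_mul, Complex.ofReal_re]
    simp [dens]
  · refine Finset.sum_congr rfl fun k hk => ?_
    rw [Finset.mem_Icc] at hk
    obtain ⟨d, rfl⟩ : ∃ d, k = j + 1 + d := ⟨k - (j + 1), by omega⟩
    rw [haeval, hpow, ← Complex.ofReal_mul, Complex.re_ofReal_mul, nikishin,
      show j + 1 + d - (j + 1) = d by omega, show j + 1 + d - j = d + 1 by omega, dens]

/-- A form is the Cauchy transform of the next one, up to a polynomial. -/
theorem IsNikishinGenerator.nikForm_eq (hσ : IsNikishinGenerator m σ) (b : ℕ → ℝ[X]) {j : ℕ}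
    (hj : j < m) :
    ∃ (ε : ℝ) (P : ℂ[X]), ε ^ 2 = 1 ∧
      HasMoments (σ (j + 1)).variation
        (fun x => ((ε * (nikForm m σ b (j + 1) (x : ℂ)).re : ℝ) : ℂ)) ∧
      ContinuousOn (fun x : ℝ => (nikForm m σ b (j + 1) (x : ℂ)).re) (Delta m σ (j + 1)) ∧
      ∀ z ∉ toPlane (Delta m σ (j + 1)), nikForm m σ b j z = P.eval z +
        cauchyTransform (σ (j + 1)).variation
          (fun x => ((ε * (nikForm m σ b (j + 1) (x : ℂ)).re : ℝ) : ℂ)) z := by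
  obtain ⟨ε, hε, hc⟩ := hσ.exists_cauchy_eq hj
  have hΔ := isClosed_Delta m σ (j + 1)
  have hae : ∀ᵐ x ∂(σ (j + 1)).variation, x ∈ Delta m σ (j + 1) := ae_mem_Delta (by omega)
  obtain ⟨hm, Q, hQ⟩ := exists_sum_mul_cauchyTransform hΔ hae (Finset.Icc (j + 1) m)
    (fun k => C ((ε : ℂ) * (-1) ^ k) * (b k).map (algebraMap ℝ ℂ)) fun k hk => (hc k hk).1
  have hfun : (fun x : ℝ => ∑ k ∈ Finset.Icc (j + 1) m,
      (C ((ε : ℂ) * (-1) ^ k) * (b k).map (algebraMap ℝ ℂ)).eval (x : ℂ) *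
        (dens σ (j + 1) (k - (j + 1)) x : ℂ)) =
      fun x : ℝ => ((ε * (nikForm m σ b (j + 1) (x : ℂ)).re : ℝ) : ℂ) := by
    funext x
    rw [nikForm_re b (by omega : j + 1 ≤ m), Finset.mul_sum, Complex.ofReal_sum]
    refine Finset.sum_congr rfl fun k _ => ?_
    have haeval : ((b k).map (algebraMap ℝ ℂ)).eval (x : ℂ) = (((b k).eval x : ℝ) : ℂ) := by
      rw [eval_map, ← aeval_def]
      exact aeval_algebraMap_apply_eq_algebraMap_eval x (b k)
    rw [eval_mul, eval_C, haeval]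
    push_cast
    ring
  rw [hfun] at hm
  simp only [hfun] at hQ
  refine ⟨ε, C ((-1) ^ j) * (b j).map (algebraMap ℝ ℂ) + Q, hε, hm, ?_, fun z hz => ?_⟩
  · simp only [nikForm_re b (by omega : j + 1 ≤ m)]
    refine continuousOn_finsetSum _ fun k hk => ?_
    exact (ContinuousOn.mul continuousOn_const (b k).continuous.continuousOn).mul (hc k hk).2.1
  · rw [eval_add, add_assoc, ← hQ z hz, nikForm]
    congr 1
    · rw [eval_mul, eval_C, eval_map, aeval_def]
    · refine Finset.sum_congr rfl fun k hk => ?_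
      rw [(hc k hk).2.2 z hz, eval_mul, eval_C, eval_map, aeval_def]
      ring

theorem IsNikishinGenerator.differentiableOn_nikForm (hσ : IsNikishinGenerator m σ)
    (b : ℕ → ℝ[X]) {j : ℕ} (hj : j ≤ m) :
    DifferentiableOn ℂ (nikForm m σ b j) (toPlane (Delta m σ (j + 1)))ᶜ := by
  rcases hj.lt_or_eq with hj | rfl
  · obtain ⟨ε, P, -, hm, -, hP⟩ := hσ.nikForm_eq b hj
    refine DifferentiableOn.congr ?_ hP
    exact P.differentiable.differentiableOn.add (differentiableOn_cauchyTransform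
      (isClosed_Delta _ _ _) (ae_mem_Delta (by omega)) hm.integrable)
  · have : nikForm j σ b j = fun z => (-1) ^ j * aeval z (b j) := by
      funext z
      simp [nikForm]
    rw [this]
    exact ((b j).differentiable_aeval.const_mul _).differentiableOn

theorem conj_mem_toPlane {Δ : Set ℝ} {z : ℂ} :
    starRingEnd ℂ z ∈ toPlane Δ ↔ z ∈ toPlane Δ := by
  have key : ∀ {z : ℂ}, z ∈ toPlane Δ → starRingEnd ℂ z ∈ toPlane Δ := by
    rintro z ⟨x, hx, rfl⟩
    exact ⟨x, hx, (Complex.conj_ofReal x).symm⟩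
  exact ⟨fun h => by simpa using key h, key⟩

theorem IsNikishinGenerator.nikForm_conj (hσ : IsNikishinGenerator m σ)
    (b : ℕ → ℝ[X]) {j : ℕ} (hj : j ≤ m) {z : ℂ} (hz : z ∉ toPlane (Delta m σ (j + 1))) :
    nikForm m σ b j (starRingEnd ℂ z) = starRingEnd ℂ (nikForm m σ b j z) := by
  rw [nikForm, nikForm, map_add, map_sum]
  congr 1
  · simp [aeval_conj]
  · refine Finset.sum_congr rfl fun k hk => ?_
    have hjm : j < m := by
      rw [Finset.mem_Icc] at hk
      omega
    obtain ⟨ε, -, hc⟩ := hσ.exists_cauchy_eq hjm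
    rw [(hc k hk).2.2 z hz, (hc k hk).2.2 _ (fun h => hz (conj_mem_toPlane.1 h)),
      cauchyTransform_conj]
    simp [aeval_conj]

theorem IsNikishinGenerator.nikForm_eq_ofReal_re (hσ : IsNikishinGenerator m σ)
    (b : ℕ → ℝ[X]) {j : ℕ} (hj : j ≤ m) {x : ℝ} (hx : x ∉ Delta m σ (j + 1)) :
    nikForm m σ b j (x : ℂ) = ((nikForm m σ b j (x : ℂ)).re : ℂ) := by
  have := hσ.nikForm_conj b hj (z := (x : ℂ)) (fun h => hx (ofReal_mem_toPlane.1 h))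
  rw [Complex.conj_ofReal] at this
  exact (Complex.conj_eq_iff_re.1 this.symm).symm

end MLHP

theorem exists_sign_mul_pos {Δ : Set ℝ} (hΔ : Convex ℝ Δ) {f : ℝ → ℝ} (hf : ContinuousOn f Δ)
    (h0 : ∀ x ∈ Δ, f x ≠ 0) : ∃ e : ℝ, e ^ 2 = 1 ∧ ∀ x ∈ Δ, 0 < e * f x := by
  by_cases hpos : ∀ x ∈ Δ, 0 < f x
  · exact ⟨1, by norm_num, fun x hx => by simpa using hpos x hx⟩
  push Not at hpos
  obtain ⟨x, hx, hfx⟩ := hpos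
  refine ⟨-1, by norm_num, fun y hy => ?_⟩
  by_contra! hle
  obtain ⟨z, hz, hz0⟩ := hΔ.isPreconnected.intermediate_value hx hy hf
    (show (0 : ℝ) ∈ Set.Icc (f x) (f y) from ⟨hfx, by linarith⟩)
  exact h0 z hz hz0

theorem MLHP.AtLeastSignChanges.of_le {N K : ℕ} (hKN : K ≤ N) {G : ℝ → ℝ} {E : Set ℝ}
    (h : MLHP.AtLeastSignChanges N G E) : MLHP.AtLeastSignChanges K G E := by
  obtain ⟨x, h1, h2, h3⟩ := h
  refine ⟨fun i => x (Fin.castLE (by omega) i), fun i j hij => h1 (by simpa using hij),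
    fun i => h2 _, fun i => ?_⟩
  exact h3 (Fin.castLE hKN i)

/-- Each factor gives a root to divide out. As `g` is only continuous, the cancelled identity is
recovered at `a` by density. -/
theorem card_le_natDegree_of_eval_eq {g : ℂ → ℂ} (hg : Continuous g) (s : Multiset ℂ) {p : ℂ[X]}
    (hp : p ≠ 0) (h : ∀ z, p.eval z = (s.map (fun a => z - a)).prod * g z) :
    s.card ≤ p.natDegree := by
  induction s using Multiset.induction_on generalizing p with
  | empty => simp
  | cons a s ih =>
    have hroot : p.IsRoot a := by rw [IsRoot.def, h]; simp
    obtain ⟨q, rfl⟩ := dvd_iff_isRoot.2 hroot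
    have hq0 : q ≠ 0 := right_ne_zero_of_mul hp
    have hq : ∀ z, q.eval z = (s.map (fun a => z - a)).prod * g z := by
      have hcont : Continuous fun z : ℂ => (s.map (fun a => z - a)).prod * g z :=
        (continuous_multiset_prod _ fun b _ => by fun_prop).mul hg
      refine fun z => congrFun (q.continuous.ext_on (dense_compl_singleton a) hcont ?_) z
      intro z hz
      have := h z
      rw [eval_mul, eval_sub, eval_X, eval_C, Multiset.map_cons, Multiset.prod_cons,
        mul_assoc] at this
      exact mul_left_cancel₀ (sub_ne_zero.2 hz) this
    rw [natDegree_mul (X_sub_C_ne_zero a) hq0, natDegree_X_sub_C, Multiset.card_cons, add_comm]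
    exact Nat.add_le_add_left (ih hq0 hq) 1

theorem HasZeros.natDegree_le {p w : ℝ[X]} (hp : p ≠ 0) (c : ℂ)
    (hw : HasZeros (fun z => c * aeval z p) Set.univ w) (hc : c ≠ 0) :
    w.natDegree ≤ p.natDegree := by
  obtain ⟨hw0, -, g, hg, hpg⟩ := hw
  have hcard : (w.map (algebraMap ℝ ℂ)).roots.card = w.natDegree := by
    rw [← (IsAlgClosed.splits _).natDegree_eq_card_roots, natDegree_map]
  have hC : C c * p.map (algebraMap ℝ ℂ) ≠ 0 :=
    mul_ne_zero (by simpa using hc) (Polynomial.map_ne_zero hp)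
  have := card_le_natDegree_of_eval_eq
    (g := fun z => (w.map (algebraMap ℝ ℂ)).leadingCoeff * g z)
    (continuous_const.mul (continuousOn_univ.1 hg)) (w.map (algebraMap ℝ ℂ)).roots hC
    (fun z => by
      rw [eval_mul, eval_C, eval_map, ← aeval_def]
      refine (hpg z (Set.mem_univ z)).trans ?_
      rw [aeval_eq_leadingCoeff_mul_prod]
      ring)
  rwa [hcard, natDegree_C_mul hc, natDegree_map] at this

/-! ### Passing zeros and sign changes from level to level. -/

namespace MLHP

variable {m : ℕ} {σ : ℕ → SignedMeasure ℝ}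

/-- The point `iy` has distance at least `y` from the real line, so the half-axis lies in the region
with `c = 1`. Nonemptiness is needed because `infDist` to the empty set is `0`. -/
theorem BigONontangential.isBigO_I {E : Set ℝ} (hE : E.Nonempty) {N : ℕ} {f : ℂ → ℂ}
    (h : BigONontangential E N f) :
    (fun y : ℝ => f ((y : ℂ) * Complex.I)) =O[atTop] fun y : ℝ => (y ^ N)⁻¹ := by
  have ht : Tendsto (fun y : ℝ => (y : ℂ) * Complex.I) atTop (Bornology.cobounded ℂ ⊓
      𝓟 {z : ℂ | 1 * ‖z‖ ≤ Metric.infDist z (toPlane E)}) := by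
    refine tendsto_inf.2 ⟨tendsto_norm_atTop_iff_cobounded.1 tendsto_norm_I_atTop, ?_⟩
    rw [tendsto_principal]
    filter_upwards [eventually_gt_atTop 0] with y hy
    rw [one_mul, Metric.le_infDist (show (toPlane E).Nonempty from hE.image _)]
    rintro _ ⟨x, -, rfl⟩
    rw [dist_eq_norm]
    refine le_trans ?_ (le_norm_I_mul_sub y x hy)
    simp [abs_of_pos hy]
  refine ((h 1 one_pos).comp_tendsto ht).trans (IsBigO.of_bound 1 ?_)
  refine Eventually.of_forall fun y => ?_
  simp

theorem IsNikishinGenerator.interior_nonempty (hσ : IsNikishinGenerator m σ) {j : ℕ}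
    (hj : 1 ≤ j) (hjm : j ≤ m) : (interior (Delta m σ j)).Nonempty := by
  rw [Delta, if_pos hjm]
  exact (hσ.classM j hj hjm).interior_hull_nonempty

/-- Zeros and decay of a form produce sign changes of the next one. -/
theorem IsNikishinGenerator.atLeastSignChanges_succ (hσ : IsNikishinGenerator m σ)
    {a b : ℕ → ℝ[X]} {j : ℕ} (hj : j < m) {T R : ℝ[X]} (hT : T ≠ 0) (hR : R ≠ 0) {e : ℝ}
    (he : e ≠ 0) (hpos : ∀ x ∈ Delta m σ (j + 1), 0 ≤ e * (R.eval x * T.eval x))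
    (hab : ∀ x : ℝ, (nikForm m σ b (j + 1) (x : ℂ)).re =
      T.eval x * (nikForm m σ a (j + 1) (x : ℂ)).re)
    {N : ℕ} (hN : 1 ≤ N)
    (hO : (fun y : ℝ => nikForm m σ b j ((y : ℂ) * Complex.I)) =O[atTop] fun y : ℝ => (y ^ N)⁻¹)
    {w : ℝ[X]} (hw : HasZeros (nikForm m σ b j) (toPlane (Delta m σ (j + 1)))ᶜ w)
    {K : ℕ} (hK : K + R.natDegree + 1 ≤ w.natDegree + N)
    (hfin : {x ∈ Delta m σ (j + 1) | (nikForm m σ a (j + 1) (x : ℂ)).re = 0}.Finite) :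
    AtLeastSignChanges K (fun x : ℝ => (nikForm m σ a (j + 1) (x : ℂ)).re)
      (interior (Delta m σ (j + 1))) := by
  have hΔ := isClosed_Delta m σ (j + 1)
  have hconv := convex_Delta m σ (j + 1)
  have hae : ∀ᵐ x ∂(σ (j + 1)).variation, x ∈ Delta m σ (j + 1) := ae_mem_Delta (by omega)
  obtain ⟨-, -, -, -, hGc, -⟩ := hσ.nikForm_eq a hj
  obtain ⟨ε, P, hε, hm, -, hP⟩ := hσ.nikForm_eq b hj
  have hw0 : ∀ x ∈ Delta m σ (j + 1), w.eval x ≠ 0 := by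
    intro x hx h0
    refine hw.2.1 (x : ℂ) ?_ (ofReal_mem_toPlane.2 hx)
    rw [show aeval (x : ℂ) w = ((w.eval x : ℝ) : ℂ) from
      aeval_algebraMap_apply_eq_algebraMap_eval x w, h0, Complex.ofReal_zero]
  obtain ⟨η, hη, hηw⟩ := exists_sign_mul_pos hconv w.continuous.continuousOn hw0
  have hη0 : η ≠ 0 := by
    rintro rfl
    norm_num at hη
  -- The factor `R` is chosen so that `R T` has constant sign, and `w` has no zero on the interval;
  -- `e` and `η` normalise both signs. The weight is thus non-negative, and the sign changes found
  -- belong to the form of `a` alone.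
  refine atLeastSignChanges_of_orthogonal (ρ := (σ (j + 1)).variation)
    (u := fun x => e * (R.eval x * T.eval x) * (η * (w.eval x)⁻¹)) hΔ hconv
    (hσ.interior_nonempty (by omega) (by omega)) hae
    (hσ.classM (j + 1) (by omega) (by omega)).infinite_supp (support_subset_Delta (by omega)) hGc
    ?_ ?_ ?_ ?_ hfin
  · refine ContinuousOn.mul ?_ (continuousOn_const.mul (w.continuous.continuousOn.inv₀ hw0))
    exact continuousOn_const.mul (R.continuous.mul T.continuous).continuousOn
  · intro x hx
    refine mul_nonneg (hpos x hx) ?_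
    have h1 := hηw x hx
    have h2 : η * (w.eval x)⁻¹ = η ^ 2 * (η * w.eval x)⁻¹ := by
      have := hw0 x hx
      field_simp
    rw [h2, hη, one_mul]
    exact (inv_pos.2 h1).le
  · refine ((R * T).roots.toFinset.finite_toSet).subset ?_
    rintro x ⟨hx, hx0⟩
    have h1 : R.eval x * T.eval x = 0 := by
      have := inv_ne_zero (hw0 x hx)
      simpa [he, hη0, this] using hx0
    have h2 : R * T ≠ 0 := mul_ne_zero hR hT
    rw [Finset.mem_coe, Multiset.mem_toFinset, mem_roots h2, IsRoot.def, eval_mul, h1]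
  · intro q hq
    -- The admissible test polynomials are `q R`, whence the loss of `deg R` in `K`. The factor `ε`
    -- cancels the one in the density, because `ε² = 1`.
    have hdeg : (C (e * η * ε) * (q * R)).natDegree + 2 ≤ w.natDegree + N := by
      have h1 := natDegree_C_mul_le (e * η * ε) (q * R)
      have h2 := natDegree_mul_le (p := q) (q := R)
      omega
    obtain ⟨hi, hz⟩ := integral_mul_div_eq_zero hΔ hae hm hP hN hO hw hdeg
    have heq : (fun x => (C (e * η * ε) * (q * R)).eval x *
        (ε * (nikForm m σ b (j + 1) (x : ℂ)).re) * (w.eval x)⁻¹) = fun x =>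
        q.eval x * (nikForm m σ a (j + 1) (x : ℂ)).re *
          (e * (R.eval x * T.eval x) * (η * (w.eval x)⁻¹)) := by
      funext x
      rw [hab, eval_mul, eval_mul, eval_C]
      calc _ = ε ^ 2 * (q.eval x * (nikForm m σ a (j + 1) (x : ℂ)).re *
          (e * (R.eval x * T.eval x) * (η * (w.eval x)⁻¹))) := by ring
        _ = _ := by rw [hε, one_mul]
    rw [heq] at hi hz
    exact ⟨hi, hz⟩

/-- Points of `Δ_j` lie off `Δ_{j+1}`, where the form is real, so a zero of the real part is a zero
of the form. -/
theorem IsNikishinGenerator.exists_hasZeros_of_finset (hσ : IsNikishinGenerator m σ)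
    (a : ℕ → ℝ[X]) {j : ℕ} (hj : 1 ≤ j) (hjm : j ≤ m) (S : Finset ℝ)
    (hS : ∀ x ∈ S, x ∈ Delta m σ j ∧ (nikForm m σ a j (x : ℂ)).re = 0) :
    (∀ x ∈ S, (x : ℂ) ∉ toPlane (Delta m σ (j + 1)) ∧ nikForm m σ a j (x : ℂ) = 0) ∧
    ∃ w, HasZeros (nikForm m σ a j) (toPlane (Delta m σ (j + 1)))ᶜ w ∧ S.card ≤ w.natDegree := by
  classical
  have hnot : ∀ x ∈ S, x ∉ Delta m σ (j + 1) := by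
    intro x hx h
    rcases hjm.lt_or_eq with hlt | rfl
    · exact Set.disjoint_left.1 (hσ.disjoint j hj hlt) (hS x hx).1 h
    · rw [Delta_succ] at h
      exact h
  have hzero : ∀ x ∈ S, (x : ℂ) ∉ toPlane (Delta m σ (j + 1)) ∧ nikForm m σ a j (x : ℂ) = 0 := by
    intro x hx
    refine ⟨fun h => hnot x hx (ofReal_mem_toPlane.1 h), ?_⟩
    rw [hσ.nikForm_eq_ofReal_re a hjm (hnot x hx), (hS x hx).2, Complex.ofReal_zero]
  refine ⟨hzero, ?_⟩
  have hU := (isClosed_toPlane (isClosed_Delta m σ (j + 1))).isOpen_compl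
  have hd := hσ.differentiableOn_nikForm a hjm
  obtain ⟨w, hw, hdeg⟩ := exists_hasZeros hU (fun z hz h => hz (conj_mem_toPlane.1 h)) hd
    (fun z hz => hσ.nikForm_conj a hjm hz) (S := S.image ((↑) : ℝ → ℂ)) (k := fun _ => 1)
    (by
      intro z hz
      obtain ⟨x, hx, rfl⟩ := Finset.mem_image.1 (Finset.mem_coe.1 hz)
      exact (hzero x hx).1)
    (by
      intro z hz
      obtain ⟨x, hx, rfl⟩ := Finset.mem_image.1 hz
      have han := hd.analyticAt (hU.mem_nhds (hzero x hx).1)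
      rw [Nat.cast_one]
      exact Order.one_le_iff_ne_zero.2 (han.analyticOrderAt_ne_zero.2 (hzero x hx).2))
  refine ⟨w, hw, ?_⟩
  rw [Finset.sum_const, Finset.card_image_of_injective _ Complex.ofReal_injective] at hdeg
  simpa using hdeg

theorem form_eq_nikForm {v t a : ℕ → ℝ[X]} {j : ℕ} (hj : 1 ≤ j) :
    form m σ v t a j = nikForm m σ a j := by
  funext z
  rw [form, if_neg (by omega)]

theorem IsMLHermitePade.isBigO_nikForm (hσ : IsNikishinGenerator m σ) {n : ℕ}
    {v t a : ℕ → ℝ[X]} (ha : IsMLHermitePade m n σ v t a) {j : ℕ} (hj : 1 ≤ j) (hjm : j < m) :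
    (fun y : ℝ => nikForm m σ a j ((y : ℂ) * Complex.I)) =O[atTop] fun y : ℝ => (y ^ 1)⁻¹ := by
  have h := (ha.order j hj hjm).isBigO_I
    ((hσ.interior_nonempty (by omega) (by omega)).mono interior_subset)
  rwa [form_eq_nikForm hj] at h

/-- If the last non-zero polynomial were `a_j` with `j < m`, then `A_j` would be `±a_j`, a
polynomial tending to zero along the imaginary axis, hence zero. -/
theorem IsMLHermitePade.last_ne_zero (hσ : IsNikishinGenerator m σ) {n : ℕ}
    {v t a : ℕ → ℝ[X]} (ha : IsMLHermitePade m n σ v t a) : a m ≠ 0 := by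
  classical
  obtain ⟨i, him, hi⟩ := ha.nontrivial
  set j := Nat.findGreatest (fun k => a k ≠ 0) m with hj
  have hj0 : a j ≠ 0 := Nat.findGreatest_spec (P := fun k => a k ≠ 0) him hi
  have hgt : ∀ k, j < k → k ≤ m → a k = 0 := fun k h1 h2 => by
    simpa using Nat.findGreatest_is_greatest h1 h2
  have hjle : j ≤ m := Nat.findGreatest_le m
  rcases hjle.lt_or_eq with hlt | heq
  swap
  · rwa [heq] at hj0
  exfalso
  have hform : ∀ z, form m σ v t a j z = (-1) ^ j * aeval z (a j) := by
    intro z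
    rw [form]
    split_ifs with h0
    · rw [h0, Finset.sum_eq_zero]
      · simp
      · intro k hk
        rw [Finset.mem_Icc] at hk
        rw [hgt k (by omega) hk.2]
        simp
    · rw [nikForm, Finset.sum_eq_zero, add_zero]
      intro k hk
      rw [Finset.mem_Icc] at hk
      rw [hgt k (by omega) hk.2]
      simp
  have hdecay : ∃ N, 1 ≤ N ∧ (fun y : ℝ => form m σ v t a j ((y : ℂ) * Complex.I)) =O[atTop]
      fun y : ℝ => (y ^ N)⁻¹ := by
    have hne : (Delta m σ (j + 1)).Nonempty :=
      (hσ.interior_nonempty (by omega) (by omega)).mono interior_subset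
    by_cases h0 : j = 0
    · rw [h0] at hne ⊢
      exact ⟨n + 1, by omega, ha.order_zero.isBigO_I hne⟩
    · exact ⟨1, le_rfl, (ha.order j (by omega) hlt).isBigO_I hne⟩
  obtain ⟨N, hN, hO⟩ := hdecay
  have ht := hO.trans_tendsto (tendsto_pow_atTop (by omega)).inv_tendsto_atTop
  have h0 : C ((-1) ^ j) * (a j).map (algebraMap ℝ ℂ) = 0 := by
    refine eq_zero_of_tendsto_eval_I (ht.congr fun y => ?_)
    rw [hform, eval_mul, eval_C, eval_map, aeval_def]
  rcases mul_eq_zero.1 h0 with h | h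
  · rw [C_eq_zero] at h
    exact pow_ne_zero j (by norm_num) h
  · exact hj0 ((Polynomial.map_eq_zero _).1 h)

theorem nikForm_last (a : ℕ → ℝ[X]) (z : ℂ) : nikForm m σ a m z = (-1) ^ m * aeval z (a m) := by
  simp [nikForm]

/-- Zeros of `A_j` produce at least as many zeros of `A_{j+1}` on `Δ_{j+1}`, up to `a_m`, whose
degree is at most `n`. If `A_{j+1}` has infinitely many zeros on `Δ_{j+1}`, orthogonality is not
needed: any number of points can be picked. -/
theorem IsMLHermitePade.natDegree_le (hσ : IsNikishinGenerator m σ) {n : ℕ}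
    {v t a : ℕ → ℝ[X]} (ha : IsMLHermitePade m n σ v t a) {j : ℕ} (hj : 1 ≤ j) (hjm : j ≤ m)
    {w : ℝ[X]} (hw : HasZeros (nikForm m σ a j) (toPlane (Delta m σ (j + 1)))ᶜ w) :
    w.natDegree ≤ n := by
  induction hjm using Nat.decreasingInduction generalizing w with
  | self =>
    rw [Delta_succ, toPlane, Set.image_empty, Set.compl_empty] at hw
    have h1 := HasZeros.natDegree_le (ha.last_ne_zero hσ) ((-1) ^ m)
      (by rwa [funext (nikForm_last a)] at hw) (pow_ne_zero m (by norm_num))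
    exact h1.trans (natDegree_le_of_degree_le ha.degree_le)
  | of_succ j hjm ih =>
    obtain ⟨S, hcard, hS⟩ : ∃ S : Finset ℝ, S.card = w.natDegree ∧ ∀ x ∈ S,
        x ∈ Delta m σ (j + 1) ∧ (nikForm m σ a (j + 1) (x : ℂ)).re = 0 := by
      by_cases hfin : {x ∈ Delta m σ (j + 1) | (nikForm m σ a (j + 1) (x : ℂ)).re = 0}.Finite
      · have h1 := hσ.atLeastSignChanges_succ (a := a) (b := a) (by omega) (T := 1) (R := 1)
          one_ne_zero one_ne_zero one_ne_zero (by simp) (by simp) le_rfl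
          (ha.isBigO_nikForm hσ hj (by omega)) hw (K := w.natDegree) (by simp) hfin
        obtain ⟨-, -, -, -, hGc, -⟩ := hσ.nikForm_eq a (by omega : j < m)
        exact exists_finset_zeros_of_signChanges (convex_Delta m σ (j + 1)) hGc
          (h1.mono interior_subset)
      · obtain ⟨S, hS, hcard⟩ := Set.Infinite.exists_subset_card_eq hfin w.natDegree
        exact ⟨S, hcard, fun x hx => hS hx⟩
    obtain ⟨-, w', hw', hdeg⟩ := hσ.exists_hasZeros_of_finset a (by omega) (by omega) S hS
    have := ih (by omega) hw'
    omega

/-- Already `n + 1` zeros would contradict `natDegree_le`. -/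
theorem IsMLHermitePade.finite_zeros (hσ : IsNikishinGenerator m σ) {n : ℕ}
    {v t a : ℕ → ℝ[X]} (ha : IsMLHermitePade m n σ v t a) {j : ℕ} (hj : 1 ≤ j) (hjm : j ≤ m) :
    {x ∈ Delta m σ j | (nikForm m σ a j (x : ℂ)).re = 0}.Finite := by
  by_contra hinf
  obtain ⟨S, hS, hcard⟩ := Set.Infinite.exists_subset_card_eq hinf (n + 1)
  obtain ⟨-, w, hw, hdeg⟩ := hσ.exists_hasZeros_of_finset a hj hjm S fun x hx => hS hx
  have := ha.natDegree_le hσ hj hjm hw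
  omega

theorem IsNikishinGenerator.exists_finset_of_signChanges (hσ : IsNikishinGenerator m σ)
    (a : ℕ → ℝ[X]) {j : ℕ} (hj : 1 ≤ j) (hjm : j ≤ m) {K : ℕ}
    (h : AtLeastSignChanges K (fun x : ℝ => (nikForm m σ a j (x : ℂ)).re)
      (interior (Delta m σ j))) :
    ∃ S : Finset ℝ, S.card = K ∧ ∀ x ∈ S, x ∈ Delta m σ j ∧
      (nikForm m σ a j (x : ℂ)).re = 0 := by
  obtain ⟨i, rfl⟩ : ∃ i, j = i + 1 := ⟨j - 1, by omega⟩
  obtain ⟨-, -, -, -, hGc, -⟩ := hσ.nikForm_eq a (by omega : i < m)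
  exact exists_finset_zeros_of_signChanges (convex_Delta m σ (i + 1)) hGc
    (h.mono interior_subset)

theorem IsMLHermitePade.signChanges_succ (hσ : IsNikishinGenerator m σ) {n : ℕ}
    {v t a : ℕ → ℝ[X]} (ha : IsMLHermitePade m n σ v t a) {j : ℕ} (hj : 1 ≤ j) (hjm : j < m)
    {w : ℝ[X]} (hw : HasZeros (nikForm m σ a j) (toPlane (Delta m σ (j + 1)))ᶜ w) :
    AtLeastSignChanges w.natDegree (fun x : ℝ => (nikForm m σ a (j + 1) (x : ℂ)).re)
      (interior (Delta m σ (j + 1))) :=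
  hσ.atLeastSignChanges_succ (a := a) (b := a) hjm (T := 1) (R := 1)
    one_ne_zero one_ne_zero one_ne_zero (by simp) (by simp) le_rfl
    (ha.isBigO_nikForm hσ hj hjm) hw (by simp) (ha.finite_zeros hσ (by omega) (by omega))

theorem IsMLHermitePade.signChanges_of_le (hσ : IsNikishinGenerator m σ) {n : ℕ}
    {v t a : ℕ → ℝ[X]} (ha : IsMLHermitePade m n σ v t a) {j k K : ℕ} (hj : 1 ≤ j) (hjk : j ≤ k)
    (hkm : k ≤ m) (h : AtLeastSignChanges K (fun x : ℝ => (nikForm m σ a j (x : ℂ)).re)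
      (interior (Delta m σ j))) :
    AtLeastSignChanges K (fun x : ℝ => (nikForm m σ a k (x : ℂ)).re)
      (interior (Delta m σ k)) := by
  induction k, hjk using Nat.le_induction with
  | base => exact h
  | succ k hjk ih =>
    obtain ⟨S, hcard, hS⟩ := hσ.exists_finset_of_signChanges a (by omega) (by omega)
      (ih (by omega))
    obtain ⟨-, w, hw, hdeg⟩ := hσ.exists_hasZeros_of_finset a (by omega) (by omega) S hS
    exact (ha.signChanges_succ hσ (by omega) (by omega) hw).of_le (by omega)

/-- A lower bound on the number of zeros of a form, realised by a real polynomial. -/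
theorem IsNikishinGenerator.exists_hasZeros_of_le (hσ : IsNikishinGenerator m σ) (b : ℕ → ℝ[X])
    {j : ℕ} (hjm : j ≤ m) {f : ℂ → ℂ} {N : ℕ}
    (hf : ∀ z ∉ toPlane (Delta m σ (j + 1)),
      zeroMult f z ≤ analyticOrderAt (nikForm m σ b j) z)
    (h : ¬ numZeros f (toPlane (Delta m σ (j + 1)))ᶜ ≤ N) :
    ∃ w, HasZeros (nikForm m σ b j) (toPlane (Delta m σ (j + 1)))ᶜ w ∧ N + 1 ≤ w.natDegree := by
  obtain ⟨S, k, hS, hk, hsum⟩ := exists_of_not_numZeros_le h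
  obtain ⟨w, hw, hdeg⟩ := exists_hasZeros
    (isClosed_toPlane (isClosed_Delta m σ (j + 1))).isOpen_compl
    (fun z hz h => hz (conj_mem_toPlane.1 h)) (hσ.differentiableOn_nikForm b hjm)
    (fun z hz => hσ.nikForm_conj b hjm hz) hS fun z hz => (hk z hz).trans (hf z (hS hz))
  exact ⟨w, hw, hsum.trans hdeg⟩

theorem IsNikishinGenerator.zeroMult_nikForm (hσ : IsNikishinGenerator m σ) (b : ℕ → ℝ[X])
    {j : ℕ} (hjm : j ≤ m) {z : ℂ} (hz : z ∉ toPlane (Delta m σ (j + 1))) :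
    zeroMult (nikForm m σ b j) z = analyticOrderAt (nikForm m σ b j) z :=
  zeroMult_eq_analyticOrderAt ((hσ.differentiableOn_nikForm b hjm).analyticAt
    ((isClosed_toPlane (isClosed_Delta m σ (j + 1))).isOpen_compl.mem_nhds hz))

end MLHP

/-! ### Clearing the denominators of the first form. -/

namespace MLHP

variable {m : ℕ} {σ : ℕ → SignedMeasure ℝ}

theorem IsLcm.ne_zero {v t : ℕ → ℝ[X]} (hvt : IsProperReduced m v t) {T : ℝ[X]}
    (hT : IsLcm m t T) : T ≠ 0 := by
  have hdvd : T ∣ ∏ k ∈ Finset.Icc 1 m, t k :=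
    hT.2 _ fun k h1 h2 => Finset.dvd_prod_of_mem t (Finset.mem_Icc.2 ⟨h1, h2⟩)
  refine ne_zero_of_dvd_ne_zero (Finset.prod_ne_zero_iff.2 fun k hk => ?_) hdvd
  rw [Finset.mem_Icc] at hk
  exact ne_zero_of_degree_gt (hvt k hk.1 hk.2).1

/-- Multiplication by `T` turns the first form into a form without rational terms. -/
theorem exists_nikForm_eq_mul_form {v t : ℕ → ℝ[X]} {T : ℝ[X]} (hT : IsLcm m t T)
    (hm : 1 ≤ m) (σ : ℕ → SignedMeasure ℝ) (a : ℕ → ℝ[X]) :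
    ∃ b : ℕ → ℝ[X],
      (∀ z : ℂ, aeval z T ≠ 0 → nikForm m σ b 0 z = aeval z T * form m σ v t a 0 z) ∧
      ∀ x : ℝ, (nikForm m σ b 1 (x : ℂ)).re = T.eval x * (nikForm m σ a 1 (x : ℂ)).re := by
  have hc : ∀ k, ∃ c, 1 ≤ k → k ≤ m → T = t k * c := fun k => by
    by_cases h : 1 ≤ k ∧ k ≤ m
    · obtain ⟨c, hc⟩ := hT.1 k h.1 h.2
      exact ⟨c, fun _ _ => hc⟩
    · exact ⟨0, fun h1 h2 => absurd ⟨h1, h2⟩ h⟩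
  choose c hc using hc
  -- The products of `T` with the rational terms are polynomials and go into `b 0`. No degree bound
  -- on `b 0` is needed, since decay removes the polynomial part.
  refine ⟨fun k => if k = 0 then T * a 0 + ∑ k ∈ Finset.Icc 1 m, (-1) ^ k * a k * (v k * c k)
    else T * a k, fun z hz => ?_, fun x => ?_⟩
  · rw [nikForm, form, if_pos rfl, if_pos rfl, mul_add, map_add, map_sum, map_mul, pow_zero,
      one_mul, add_assoc, ← Finset.sum_add_distrib, Finset.mul_sum, zero_add]
    congr 1
    refine Finset.sum_congr rfl fun k hk => ?_
    rw [Finset.mem_Icc] at hk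
    have hTk := congrArg (aeval z) (hc k hk.1 hk.2)
    rw [map_mul] at hTk
    have ht0 : aeval z (t k) ≠ 0 := fun h => hz (by rw [hTk, h, zero_mul])
    rw [if_neg (by omega)]
    simp only [map_mul, map_pow, map_neg, map_one]
    rw [hTk]
    field_simp
    ring
  · rw [nikForm_re _ hm, nikForm_re _ hm, Finset.mul_sum]
    refine Finset.sum_congr rfl fun k hk => ?_
    rw [Finset.mem_Icc] at hk
    rw [if_neg (by omega), eval_mul]
    ring

theorem eventually_aeval_I_ne_zero {T : ℝ[X]} (hT : T ≠ 0) :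
    ∀ᶠ y : ℝ in atTop, aeval ((y : ℂ) * Complex.I) T ≠ 0 := by
  have hT0 : T.map (algebraMap ℝ ℂ) ≠ 0 := Polynomial.map_ne_zero hT
  have hlarge : ∀ᶠ y : ℝ in atTop, ∀ a ∈ (T.map (algebraMap ℝ ℂ)).roots.toFinset, ‖a‖ < y :=
    (Filter.eventually_all_finset _).2 fun a _ => eventually_gt_atTop ‖a‖
  filter_upwards [hlarge, eventually_gt_atTop 0] with y hy hy0 h0
  have := hy ((y : ℂ) * Complex.I) (by
    rw [Multiset.mem_toFinset, mem_roots hT0, IsRoot.def, eval_map, ← aeval_def, h0])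
  simp [abs_of_pos hy0] at this

/-- Orders add, and `p` has non-negative order, so `f` has order at most that of `g`; a pole of `f`
counts as multiplicity `0`. -/
theorem zeroMult_le_analyticOrderAt_of_mul {f g p : ℂ → ℂ} {z : ℂ} (hg : AnalyticAt ℂ g z)
    (hp : AnalyticAt ℂ p z) (hp0 : analyticOrderAt p z ≠ ⊤)
    (h : ∀ w, p w ≠ 0 → g w = p w * f w) : zeroMult f z ≤ analyticOrderAt g z := by
  have hne : ∀ᶠ w in nhdsWithin z {z}ᶜ, p w ≠ 0 :=
    hp.eventually_eq_zero_or_eventually_ne_zero.resolve_left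
      fun h0 => hp0 (analyticOrderAt_eq_top.2 h0)
  have hf : MeromorphicAt f z := by
    refine (hg.meromorphicAt.div hp.meromorphicAt).congr ?_
    filter_upwards [hne] with w hw
    rw [Pi.div_apply, h w hw, mul_div_cancel_left₀ _ hw]
  have hord : meromorphicOrderAt g z = meromorphicOrderAt p z + meromorphicOrderAt f z := by
    rw [← meromorphicOrderAt_mul hp.meromorphicAt hf]
    refine meromorphicOrderAt_congr ?_
    filter_upwards [hne] with w hw
    exact h w hw
  rw [hp.meromorphicOrderAt_eq, hg.meromorphicOrderAt_eq] at hord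
  rw [zeroMult]
  obtain ⟨d, hd⟩ := ENat.ne_top_iff_exists.1 hp0
  rw [← hd] at hord
  cases hgz : analyticOrderAt g z with
  | top => exact le_top
  | coe N =>
    rw [hgz] at hord
    cases hfz : meromorphicOrderAt f z with
    | top =>
      rw [hfz] at hord
      simp at hord
    | coe k =>
      rw [hfz] at hord
      rw [ENat.map_natCast, ENat.map_natCast] at hord
      have hk : (N : ℤ) = d + k := by exact_mod_cast hord
      change ((Int.toNat k : ℕ) : ℕ∞) ≤ (N : ℕ∞)
      exact_mod_cast (by omega : Int.toNat k ≤ N)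

theorem hasZeros_one {f : ℂ → ℂ} {U : Set ℂ} (hf : ContinuousOn f U) : HasZeros f U 1 :=
  ⟨one_ne_zero, fun z hz => absurd hz (by simp), f, hf, fun z _ => by simp⟩

theorem AtLeastSignChanges.of_const_mul {N : ℕ} {G : ℝ → ℝ} {E : Set ℝ} {c : ℝ}
    (h : AtLeastSignChanges N (fun x => c * G x) E) : AtLeastSignChanges N G E := by
  obtain ⟨x, h1, h2, h3⟩ := h
  refine ⟨x, h1, h2, fun i => ?_⟩
  have h4 := h3 i
  have h5 : c * G (x i.castSucc) * (c * G (x i.succ)) =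
      c ^ 2 * (G (x i.castSucc) * G (x i.succ)) := by ring
  rw [h5] at h4
  exact (mul_neg_iff.1 h4).elim (fun h => h.2) fun h => absurd h.1 (not_lt.2 (sq_nonneg c))

end MLHP

/-! ### The zero and sign-change counts. -/

theorem lemma3p1 (m n : ℕ) (hm : 1 ≤ m) (σ : ℕ → SignedMeasure ℝ)
    (hσ : MLHP.IsNikishinGenerator m σ)
    (v t : ℕ → ℝ[X]) (hvt : MLHP.IsProperReduced m v t)
    (T : ℝ[X]) (hT : MLHP.IsLcm m t T) (hn : 2 * T.natDegree ≤ n)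
    (a : ℕ → ℝ[X]) (ha : MLHP.IsMLHermitePade m n σ v t a) :
    (∀ j, 1 ≤ j → j ≤ m →
      MLHP.AtLeastSignChanges (n - 2 * T.natDegree)
        (fun x : ℝ => (MLHP.form m σ v t a j (x : ℂ)).re) (interior (MLHP.Delta m σ j)) ∧
      MLHP.numZeros (MLHP.form m σ v t a j) (MLHP.toPlane (MLHP.Delta m σ (j + 1)))ᶜ ≤ n) ∧
    MLHP.numZeros (MLHP.form m σ v t a 0) (MLHP.toPlane (MLHP.Delta m σ 1))ᶜ
      ≤ ((2 * T.natDegree : ℕ) : ℕ∞) ∧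
    ((∀ x ∈ MLHP.Delta m σ 1, T.eval x ≠ 0) →
      (∀ j, 1 ≤ j → j ≤ m →
        MLHP.AtLeastSignChanges (n - T.natDegree)
          (fun x : ℝ => (MLHP.form m σ v t a j (x : ℂ)).re) (interior (MLHP.Delta m σ j))) ∧
      MLHP.numZeros (MLHP.form m σ v t a 0) (MLHP.toPlane (MLHP.Delta m σ 1))ᶜ
        ≤ (T.natDegree : ℕ∞) ∧
      (MLHP.ExactlySignChanges (n - T.natDegree) (fun x : ℝ => (a m).eval x) (MLHP.Delta m σ m) →
        MLHP.numZeros (MLHP.form m σ v t a 0) (MLHP.toPlane (MLHP.Delta m σ 1))ᶜ = 0 ∧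
        ∀ j, 1 ≤ j → j < m →
          MLHP.numZeros (MLHP.form m σ v t a j) (MLHP.toPlane (MLHP.Delta m σ (j + 1)))ᶜ
            = ((n - T.natDegree : ℕ) : ℕ∞) ∧
          ∀ z : ℂ, z ∉ MLHP.toPlane (MLHP.Delta m σ (j + 1)) → MLHP.form m σ v t a j z = 0 →
            MLHP.zeroMult (MLHP.form m σ v t a j) z = 1 ∧
            z ∈ MLHP.toPlane (MLHP.Delta m σ j))) := by
  have hT0 := hT.ne_zero hvt
  obtain ⟨b, hb, hab⟩ := MLHP.exists_nikForm_eq_mul_form (v := v) hT hm σ a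
  set D := T.natDegree with hD
  have hU1 : (MLHP.Delta m σ 1).Nonempty := (hσ.interior_nonempty le_rfl hm).mono interior_subset
  -- Multiplication by `T` costs `D` orders of decay.
  have hO : (fun y : ℝ => MLHP.nikForm m σ b 0 ((y : ℂ) * Complex.I)) =O[atTop]
      fun y : ℝ => (y ^ (n + 1 - D))⁻¹ := by
    have h1 := isBigO_eval_I (T.map (algebraMap ℝ ℂ)) (natDegree_map (algebraMap ℝ ℂ)).le
    refine (h1.mul (ha.order_zero.isBigO_I hU1)).congr' ?_ ?_
    · filter_upwards [MLHP.eventually_aeval_I_ne_zero hT0] with y hy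
      rw [hb _ hy, eval_map, ← aeval_def]
    · filter_upwards [eventually_gt_atTop 0] with y hy
      rw [← hD, show n + 1 = D + (n + 1 - D) by omega, pow_add, mul_inv, ← mul_assoc,
        mul_inv_cancel₀ (by positivity), one_mul, Nat.add_sub_cancel_left]
  have hcont : ContinuousOn (MLHP.nikForm m σ b 0) (MLHP.toPlane (MLHP.Delta m σ (0 + 1)))ᶜ :=
    (hσ.differentiableOn_nikForm b (Nat.zero_le m)).continuousOn
  have hord : ∀ z ∉ MLHP.toPlane (MLHP.Delta m σ (0 + 1)),
      MLHP.zeroMult (MLHP.form m σ v t a 0) z ≤ analyticOrderAt (MLHP.nikForm m σ b 0) z := by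
    intro z hz
    refine MLHP.zeroMult_le_analyticOrderAt_of_mul (p := fun w => aeval w T)
      ((hσ.differentiableOn_nikForm b (Nat.zero_le m)).analyticAt
        ((isClosed_toPlane (MLHP.isClosed_Delta m σ (0 + 1))).isOpen_compl.mem_nhds hz))
      (T.differentiable_aeval.analyticAt z) ?_ hb
    intro htop
    have hzero := AnalyticOnNhd.eq_of_eventuallyEq
      (fun w _ => T.differentiable_aeval.analyticAt w : AnalyticOnNhd ℂ (fun w : ℂ => aeval w T) _)
      (fun _ _ => analyticAt_const) (analyticOrderAt_eq_top.1 htop)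
    obtain ⟨y, hy⟩ := (MLHP.eventually_aeval_I_ne_zero hT0).exists
    exact hy (congrFun hzero _)
  have hfin := fun {j : ℕ} (h1 : 1 ≤ j) (h2 : j ≤ m) => ha.finite_zeros hσ h1 h2
  -- With `R = T` the weight contains `T²`, and `K + D + 1 ≤ deg w + (n + 1 - D)` allows `K = deg w
  -- + n - 2D`.
  have hfirst : ∀ w, HasZeros (MLHP.nikForm m σ b 0) (MLHP.toPlane (MLHP.Delta m σ (0 + 1)))ᶜ w →
      MLHP.AtLeastSignChanges (w.natDegree + (n - 2 * D))
        (fun x : ℝ => (MLHP.nikForm m σ a 1 (x : ℂ)).re) (interior (MLHP.Delta m σ 1)) := by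
    intro w hw
    exact hσ.atLeastSignChanges_succ (j := 0) (by omega) hT0 hT0 one_ne_zero
      (fun x _ => by rw [one_mul]; exact mul_self_nonneg _) hab (by omega) hO hw (by omega)
      (hfin le_rfl hm)
  -- Here `T` itself has constant sign on `Δ_1`, so `R = 1` suffices and `D` sign changes are
  -- gained.
  have hfirst' : (∀ x ∈ MLHP.Delta m σ 1, T.eval x ≠ 0) → ∀ w,
      HasZeros (MLHP.nikForm m σ b 0) (MLHP.toPlane (MLHP.Delta m σ (0 + 1)))ᶜ w →
      MLHP.AtLeastSignChanges (w.natDegree + (n - D))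
        (fun x : ℝ => (MLHP.nikForm m σ a 1 (x : ℂ)).re) (interior (MLHP.Delta m σ 1)) := by
    intro hTne w hw
    obtain ⟨e, he, hepos⟩ := exists_sign_mul_pos (MLHP.convex_Delta m σ 1)
      T.continuous.continuousOn hTne
    have he0 : e ≠ 0 := by
      rintro rfl
      norm_num at he
    exact hσ.atLeastSignChanges_succ (j := 0) (by omega) hT0 one_ne_zero he0
      (fun x hx => by rw [eval_one, one_mul]; exact (hepos x hx).le) hab (by omega) hO hw
      (by rw [natDegree_one]; omega) (hfin le_rfl hm)
  have hzeros_le : ∀ {j K : ℕ}, 1 ≤ j → j ≤ m → MLHP.AtLeastSignChanges K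
      (fun x : ℝ => (MLHP.nikForm m σ a j (x : ℂ)).re) (interior (MLHP.Delta m σ j)) →
      K ≤ n := by
    intro j K h1 h2 h
    obtain ⟨S, hcard, hS⟩ := hσ.exists_finset_of_signChanges a h1 h2 h
    obtain ⟨-, w, hw, hdeg⟩ := hσ.exists_hasZeros_of_finset a h1 h2 S hS
    have := ha.natDegree_le hσ h1 h2 hw
    omega
  refine ⟨fun j h1 h2 => ?_, ?_, fun hTne => ⟨fun j h1 h2 => ?_, ?_, fun hex => ?_⟩⟩
  · rw [MLHP.form_eq_nikForm h1]
    refine ⟨?_, ?_⟩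
    · have := ha.signChanges_of_le hσ le_rfl h1 h2 (hfirst 1 (MLHP.hasZeros_one hcont))
      simpa using this
    · by_contra hlt
      obtain ⟨w, hw, hdeg⟩ := hσ.exists_hasZeros_of_le a h2
        (fun z hz => (hσ.zeroMult_nikForm a h2 hz).le) hlt
      have := ha.natDegree_le hσ h1 h2 hw
      omega
  -- With `2D + 1` zeros, `A_1` would have `n + 1` sign changes.
  · by_contra hlt
    obtain ⟨w, hw, hdeg⟩ := hσ.exists_hasZeros_of_le b (Nat.zero_le m) hord hlt
    have := hzeros_le le_rfl hm (hfirst w hw)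
    omega
  · rw [MLHP.form_eq_nikForm h1]
    have := ha.signChanges_of_le hσ le_rfl h1 h2 (hfirst' hTne 1 (MLHP.hasZeros_one hcont))
    simpa using this
  · by_contra hlt
    obtain ⟨w, hw, hdeg⟩ := hσ.exists_hasZeros_of_le b (Nat.zero_le m) hord hlt
    have := hzeros_le le_rfl hm (hfirst' hTne w hw)
    omega
  · have hlast : ∀ {K : ℕ}, MLHP.AtLeastSignChanges K
        (fun x : ℝ => (MLHP.nikForm m σ a m (x : ℂ)).re) (interior (MLHP.Delta m σ m)) →
        K ≤ n - D := by
      intro K hK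
      by_contra! hlt
      refine hex.2 (MLHP.AtLeastSignChanges.of_const_mul (c := (-1) ^ m) ?_)
      have h1 := (hK.of_le (K := n - D + 1) (by omega)).mono interior_subset
      simp only [MLHP.nikForm_re a le_rfl, Finset.Icc_self, Finset.sum_singleton, Nat.sub_self,
        MLHP.dens, mul_one] at h1
      exact h1
    refine ⟨?_, fun j h1 h2 => ?_⟩
    -- A single zero of `A_0` would give `n - D + 1` sign changes of `A_1`, and these propagate to
    -- `a_m`.
    · rw [← nonpos_iff_eq_zero]
      by_contra hlt
      obtain ⟨w, hw, hdeg⟩ := hσ.exists_hasZeros_of_le (N := 0) b (Nat.zero_le m) hord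
        (by simpa using hlt)
      have := hlast (ha.signChanges_of_le hσ le_rfl hm le_rfl (hfirst' hTne w hw))
      omega
    rw [MLHP.form_eq_nikForm h1]
    have hle : MLHP.numZeros (MLHP.nikForm m σ a j) (MLHP.toPlane (MLHP.Delta m σ (j + 1)))ᶜ
        ≤ ((n - D : ℕ) : ℕ∞) := by
      by_contra hlt
      obtain ⟨w, hw, hdeg⟩ := hσ.exists_hasZeros_of_le a h2.le
        (fun z hz => (hσ.zeroMult_nikForm a h2.le hz).le) hlt
      have := hlast (ha.signChanges_of_le hσ (by omega) (by omega) le_rfl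
        (ha.signChanges_succ hσ h1 h2 hw))
      omega
    have hsc := ha.signChanges_of_le hσ le_rfl h1 h2.le
      (hfirst' hTne 1 (MLHP.hasZeros_one hcont))
    rw [natDegree_one, zero_add] at hsc
    obtain ⟨S, hcard, hS⟩ := hσ.exists_finset_of_signChanges a h1 h2.le hsc
    obtain ⟨hS0, -⟩ := hσ.exists_hasZeros_of_finset a h1 h2.le S hS
    classical
    have hone : ∀ z ∉ MLHP.toPlane (MLHP.Delta m σ (j + 1)), MLHP.nikForm m σ a j z = 0 →
        1 ≤ MLHP.zeroMult (MLHP.nikForm m σ a j) z := by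
      intro z hz h0
      rw [hσ.zeroMult_nikForm a h2.le hz]
      refine Order.one_le_iff_ne_zero.2 ?_
      exact (((hσ.differentiableOn_nikForm a h2.le).analyticAt
        ((isClosed_toPlane (MLHP.isClosed_Delta m σ (j + 1))).isOpen_compl.mem_nhds
          hz)).analyticOrderAt_ne_zero).2 h0
    set S' : Finset ℂ := S.image ((↑) : ℝ → ℂ) with hS'
    have hcard' : S'.card = n - D := by
      rw [hS', Finset.card_image_of_injective _ Complex.ofReal_injective, hcard]
    have hS'0 : ∀ z ∈ S', z ∉ MLHP.toPlane (MLHP.Delta m σ (j + 1)) ∧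
        MLHP.nikForm m σ a j z = 0 := by
      intro z hz
      obtain ⟨x, hx, rfl⟩ := Finset.mem_image.1 hz
      exact hS0 x hx
    have hsum : ∀ {R : Finset ℂ}, (R : Set ℂ) ⊆ (MLHP.toPlane (MLHP.Delta m σ (j + 1)))ᶜ →
        ∑ z ∈ R, MLHP.zeroMult (MLHP.nikForm m σ a j) z ≤
          MLHP.numZeros (MLHP.nikForm m σ a j) (MLHP.toPlane (MLHP.Delta m σ (j + 1)))ᶜ :=
      fun {R} hR => le_iSup₂ (f := fun (S : Finset ℂ) (_ : (S : Set ℂ) ⊆ _) =>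
        ∑ z ∈ S, MLHP.zeroMult (MLHP.nikForm m σ a j) z) R hR
    have hge : ∀ {R : Finset ℂ}, (∀ z ∈ R, z ∉ MLHP.toPlane (MLHP.Delta m σ (j + 1)) ∧
        MLHP.nikForm m σ a j z = 0) →
        (R.card : ℕ∞) ≤ ∑ z ∈ R, MLHP.zeroMult (MLHP.nikForm m σ a j) z := by
      intro R hR
      rw [Finset.card_eq_sum_ones, Nat.cast_sum]
      exact Finset.sum_le_sum fun z hz => by
        rw [Nat.cast_one]
        exact hone z (hR z hz).1 (hR z hz).2
    -- The `n - D` distinct points of `S'`, all on `Δ_j`, exhaust the total multiplicity allowed by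
    -- `hle`; so there is no other zero, and each of them is simple.
    refine ⟨le_antisymm hle ?_, fun z hz h0 => ?_⟩
    · rw [← hcard']
      exact (hge hS'0).trans (hsum fun z hz => (hS'0 z hz).1)
    have hzS : z ∈ S' := by
      by_contra hzS
      have hins : ∀ y ∈ insert z S', y ∉ MLHP.toPlane (MLHP.Delta m σ (j + 1)) ∧
          MLHP.nikForm m σ a j y = 0 := by
        intro y hy
        rcases Finset.mem_insert.1 hy with rfl | hy
        · exact ⟨hz, h0⟩
        · exact hS'0 y hy
      have h3 := ((hge hins).trans (hsum fun y hy => (hins y hy).1)).trans hle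
      rw [Finset.card_insert_of_notMem hzS, hcard'] at h3
      have : n - D + 1 ≤ n - D := by exact_mod_cast h3
      omega
    refine ⟨le_antisymm ?_ (hone z hz h0), ?_⟩
    · have h3 := (hsum fun y hy => (hS'0 y hy).1).trans hle
      rw [← Finset.add_sum_erase _ _ hzS] at h3
      have h4 := hge (R := S'.erase z) fun y hy => hS'0 y (Finset.mem_of_mem_erase hy)
      have h5 : 1 ≤ n - D := by
        rw [← hcard']
        exact Finset.card_pos.2 ⟨z, hzS⟩
      have h6 := (add_le_add_right h4 (MLHP.zeroMult (MLHP.nikForm m σ a j) z)).trans h3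
      rw [Finset.card_erase_of_mem hzS, hcard'] at h6
      have h7 : ((n - D : ℕ) : ℕ∞) = 1 + ((n - D - 1 : ℕ) : ℕ∞) := by
        exact_mod_cast (by omega : n - D = 1 + (n - D - 1))
      rw [h7] at h6
      exact (ENat.add_le_add_iff_right (ENat.natCast_ne_top _)).1 h6
    · obtain ⟨x, hx, rfl⟩ := Finset.mem_image.1 hzS
      exact ofReal_mem_toPlane.2 (hS x hx).1
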